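/- For an integer $n\ge 1$ and $0<\rho\le 1$, say that a graph on $n$ vertices has the property $\rho$-IndepSet if it has an independent set of at least $\rho n$ vertices. A graph $G$ on $n$ vertices is $\epsilon$-close to $\rho$-IndepSet if it can be given the property by adding or removing at most $\epsilon n^2$ edges, and $\epsilon$-far from it if at least $\epsilon n^2$ edges must be added or removed to give it the property. For constants $\delta_1>\delta_2$, an $(\epsilon_1,\epsilon_2)$-tolerant tester with sample size $s\le n$ draws a uniformly random set $S$ of $s$ vertices (without replacement), inspects only $G[S]$, and (possibly using further randomness) accepts with probability at least $\delta_1$ if $G$ is $\epsilon_1$-close to $\rho$-IndepSet, and with probability at most $\delta_2$ if $G$ is $\epsilon_2$-far from it. The sample complexity of $(\epsilon_1,\epsilon_2)$-tolerant testing is the least $s$ for which such a tester exists. Write $\log=\log_2$. Theorem. There are absolute constants $c,C_1,C_2>0$ and $0<\delta_2<\delta_1<1$ such that for all $\epsilon>0$, all $\rho\in(0,1]$ and all $n\ge 1$, with $\epsilon_1=\frac{\epsilon}{c\log^4(1/\epsilon)}$ (for $\epsilon=1$, where no graph is $\epsilon$-far, $\epsilon_1$ is read as $0$): (a) The sample complexity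 of $(\epsilon_1,\epsilon)$-tolerant testing of $\rho$-IndepSet on $n$-vertex graphs is at most $C_1\,\frac{\rho^3}{\epsilon^2}\,\log^5\!\left(2+\frac{\rho^3}{\epsilon^2}\right)$; that is, it is $\widetilde O(\rho^3/\epsilon^2)$, uniformly in $n$. (b) Let $s=\max\left(0,\left\lceil C_2\,\rho^3\log^5(1/\epsilon)/\epsilon^2\right\rceil\right)$. If $n\ge s$, then the following is an $(\epsilon_1,\epsilon)$-tolerant tester for $\rho$-IndepSet with sample size $s$ (and thresholds $\delta_1,\delta_2$): accept if and only if the sample $S$ contains a set of exactly $\lfloor\rho s\rfloor$ vertices that spans at most $2\epsilon_1 s^2$ edges. -/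

import Mathlib

noncomputable section

namespace DenseTesting

/-- The number of edges that have to be added or removed to turn `G` into `H`. -/
def editDist {n : ℕ} (G H : SimpleGraph (Fin n)) : ℕ :=
  (symmDiff G.edgeSet H.edgeSet).ncard

/-- `G` is `ε`-close to the property `P`: it can be given the property `P` by adding or removing
at most `ε n²` edges. -/
def IsClose {n : ℕ} (P : Set (SimpleGraph (Fin n))) (ε : ℝ) (G : SimpleGraph (Fin n)) : Prop :=
  ∃ H ∈ P, (editDist G H : ℝ) ≤ ε * (n : ℝ) ^ 2

/-- `G` is `ε`-far from the property `P`: at least `ε n²` edges must be added or removed to give it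
the property `P`. -/
def IsFar {n : ℕ} (P : Set (SimpleGraph (Fin n))) (ε : ℝ) (G : SimpleGraph (Fin n)) : Prop :=
  ∀ H ∈ P, ε * (n : ℝ) ^ 2 ≤ (editDist G H : ℝ)

/-- The `ρ`-independent-set property of `n`-vertex graphs: some independent set has at least
`ρ n` vertices (equivalently, exactly `⌈ρ n⌉` vertices). -/
def IndepSetProperty (n : ℕ) (ρ : ℝ) : Set (SimpleGraph (Fin n)) :=
  {G | ∃ I : Finset (Fin n), G.IsIndepSet (I : Set (Fin n)) ∧ ρ * (n : ℝ) ≤ (I.card : ℝ)}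

/-- A (randomized) decision rule that sees a sample `S` of the vertices and the induced subgraph
`G[S]`, and nothing else of `G`. Its value is the probability (over its internal
randomness) with which it accepts. -/
abbrev DecisionRule (n : ℕ) : Type :=
  (S : Finset (Fin n)) → SimpleGraph (S : Set (Fin n)) → unitInterval

/-- The probability that the rule `A` accepts `G` when `S` is a uniformly random set of `s`
vertices, sampled without replacement (meaningful for `s ≤ n`). -/
def acceptProb {n : ℕ} (s : ℕ) (A : DecisionRule n) (G : SimpleGraph (Fin n)) : ℝ :=
  (∑ S ∈ (Finset.univ : Finset (Fin n)).powersetCard s,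
    (A S (G.induce (S : Set (Fin n))) : ℝ)) / (n.choose s : ℝ)

/-- The rule `A`, run on a uniformly random sample of `s` vertices, is an `(ε₁, ε₂)`-tolerant
tester for `P` on `n`-vertex graphs with acceptance thresholds `δ₁` (for close graphs) and `δ₂`
(for far graphs). -/
def IsTolerantTester {n : ℕ} (δ₁ δ₂ ε₁ ε₂ : ℝ) (P : Set (SimpleGraph (Fin n)))
    (s : ℕ) (A : DecisionRule n) : Prop :=
  s ≤ n ∧
  (∀ G : SimpleGraph (Fin n), IsClose P ε₁ G → δ₁ ≤ acceptProb s A G) ∧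
  (∀ G : SimpleGraph (Fin n), IsFar P ε₂ G → acceptProb s A G ≤ δ₂)

/-- The sample complexity of `(ε₁, ε₂)`-tolerant testing of `P` on `n`-vertex graphs: the least
`s` for which a tester with `s` samples exists (`⊤` if there is none). -/
def sampleComplexity {n : ℕ} (δ₁ δ₂ ε₁ ε₂ : ℝ) (P : Set (SimpleGraph (Fin n))) : ℕ∞ :=
  ⨅ s ∈ {s : ℕ | ∃ A : DecisionRule n, IsTolerantTester δ₁ δ₂ ε₁ ε₂ P s A}, (s : ℕ∞)

open Classical in
/-- The rule that accepts iff the sample contains a set `J` of exactly `k` vertices that spans at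
most `m` edges. -/
def sparseSubsetRule (n k : ℕ) (m : ℝ) : DecisionRule n := fun S H =>
  if ∃ J : Finset (S : Set (Fin n)), J.card = k ∧
      ((H.induce (J : Set (S : Set (Fin n)))).edgeSet.ncard : ℝ) ≤ m
  then 1 else 0

end DenseTesting

end

/-!
Let `J` be a subset of the sample with about `ρ s` vertices that spans few edges. The graph
container method finds a short word of vertices of `J`, the fingerprint, that determines a set of
vertices, the container, which holds most of `J`: as long as the container of the current word is
dense, some vertex of `J` shrinks it much faster than it shrinks its intersection with `J`. Run at
the scales `ρ / 2 ^ i`, and in a graph that is far from having an independent set of density `ρ`,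
this ends with two words whose containers meet in a set `C` of density `ρ - δ`, although `C` holds
at least `(ρ - δ / 2) s` vertices of the sample. For a fixed pair of words a Chernoff bound makes
this unlikely, and a union bound over all short pairs gives soundness.

For completeness, a large set that spans few edges meets the sample in at least `⌊ρ s⌋` vertices
with probability at least `1 / 4`, because the hypergeometric distribution is log-concave, and by
Markov's inequality a sparse subset of that size can be found there.
-/

namespace DenseTesting

open Finset

lemma choose_sub_le_pow_mul {b w : ℕ} (hwb : w ≤ b) :
    ∀ {t : ℕ}, t ≤ w → ((b - t).choose (w - t) : ℝ) ≤ ((w : ℝ) / b) ^ t * b.choose w := by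
  intro t
  induction t generalizing b w with
  | zero => simp
  | succ t ih =>
    intro htw
    obtain ⟨w, rfl⟩ : ∃ w', w = w' + 1 := ⟨w - 1, by omega⟩
    obtain ⟨b, rfl⟩ : ∃ b', b = b' + 1 := ⟨b - 1, by omega⟩
    have hwb' : (w : ℝ) ≤ b := by exact_mod_cast Nat.le_of_succ_le_succ hwb
    have hratio : (w : ℝ) / b ≤ ((w + 1 : ℕ) : ℝ) / (b + 1 : ℕ) := by
      refine div_le_of_le_mul₀ (by positivity) (by positivity) ?_
      rw [div_mul_eq_mul_div, le_div_iff₀ (by positivity)]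
      push_cast
      linarith
    have hchoose : (b.choose w : ℝ) = ((w + 1 : ℕ) : ℝ) / (b + 1 : ℕ) * (b + 1).choose (w + 1) := by
      rw [div_mul_eq_mul_div, eq_div_iff (by positivity), mul_comm, mul_comm ((w + 1 : ℕ) : ℝ)]
      exact_mod_cast Nat.add_one_mul_choose_eq b w
    calc ((b + 1 - (t + 1)).choose (w + 1 - (t + 1)) : ℝ)
        = ((b - t).choose (w - t) : ℝ) := by rw [Nat.add_sub_add_right, Nat.add_sub_add_right]
      _ ≤ ((w : ℝ) / b) ^ t * b.choose w :=
        ih (Nat.le_of_succ_le_succ hwb) (Nat.le_of_succ_le_succ htw)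
      _ ≤ (((w + 1 : ℕ) : ℝ) / (b + 1 : ℕ)) ^ t * b.choose w := by gcongr
      _ = _ := by rw [hchoose, pow_succ, mul_assoc]

section Subsets

variable {V : Type*} [DecidableEq V] {B : Finset V} {w : ℕ}

lemma card_filter_subset_le {T : Finset V} (hw : w ≤ #B) :
    (#{S ∈ B.powersetCard w | T ⊆ S} : ℝ) ≤ ((w : ℝ) / #B) ^ #T * (#B).choose w := by
  by_cases h : T ⊆ B ∧ #T ≤ w
  · rw [card_filter_powersetCard_subset _ _ _ h.1 h.2]
    exact choose_sub_le_pow_mul hw h.2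
  · rw [filter_eq_empty_iff.2, card_empty, Nat.cast_zero]
    · positivity
    · intro S hS hTS
      rw [mem_powersetCard] at hS
      exact h ⟨hTS.trans hS.1, hS.2 ▸ card_le_card hTS⟩

lemma sum_card_filter_subset_le {ι : Type*} {E : Finset ι} {supp : ι → Finset V} {r : ℕ}
    (hsupp : ∀ e ∈ E, #(supp e) = r) (hw : w ≤ #B) :
    (∑ W ∈ B.powersetCard w, #{e ∈ E | supp e ⊆ W} : ℝ) ≤
      ((w : ℝ) / #B) ^ r * #E * (#B).choose w := by
  calc (∑ W ∈ B.powersetCard w, #{e ∈ E | supp e ⊆ W} : ℝ)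
      = ∑ e ∈ E, (#{W ∈ B.powersetCard w | supp e ⊆ W} : ℝ) := by
        exact_mod_cast (sum_card_bipartiteAbove_eq_sum_card_bipartiteBelow
          (s := E) (t := B.powersetCard w) fun e W => supp e ⊆ W).symm
    _ ≤ ∑ _e ∈ E, ((w : ℝ) / #B) ^ r * (#B).choose w :=
        sum_le_sum fun e he => hsupp e he ▸ card_filter_subset_le hw
    _ = _ := by rw [sum_const, nsmul_eq_mul]; ring

end Subsets

section Adjacencies

variable {V : Type*} {G : SimpleGraph V}

open Classical in
/-- The number of neighbours of `v` in `C`. -/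
noncomputable def degInto (G : SimpleGraph V) (C : Finset V) (v : V) : ℕ := #{u ∈ C | G.Adj v u}

open Classical in
/-- The number of pairs `(a, b) ∈ A × B` with `a` adjacent to `b`; each edge inside `A` is counted
twice in `adjPairs G A A`. -/
noncomputable def adjPairs (G : SimpleGraph V) (A B : Finset V) : ℕ := #(G.interedges A B)

lemma adjPairs_eq_sum_degInto (A B : Finset V) : adjPairs G A B = ∑ a ∈ A, degInto G B a := by
  simp only [adjPairs, SimpleGraph.interedges, Rel.interedges, degInto, card_filter, sum_product]

lemma exists_degInto_mul_card_le {A : Finset V} (hA : A.Nonempty) (B : Finset V) :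
    ∃ v ∈ A, degInto G B v * #A ≤ adjPairs G A B := by
  by_contra! h
  have hlt := sum_lt_sum_of_nonempty hA h
  rw [← sum_mul, ← adjPairs_eq_sum_degInto, sum_const, smul_eq_mul, mul_comm] at hlt
  exact hlt.false

lemma adjPairs_mono {A A' B B' : Finset V} (hA : A ⊆ A') (hB : B ⊆ B') :
    adjPairs G A B ≤ adjPairs G A' B' := by
  classical exact card_le_card (SimpleGraph.interedges_mono G hA hB)

lemma adjPairs_comm (A B : Finset V) : adjPairs G A B = adjPairs G B A := by
  classical
  have : Std.Symm G.Adj := ⟨fun _ _ => SimpleGraph.Adj.symm⟩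
  exact Rel.card_interedges_comm A B

lemma adjPairs_le_mul (A B : Finset V) : adjPairs G A B ≤ #A * #B := by
  classical exact SimpleGraph.card_interedges_le_mul G A B

lemma adjPairs_union_left [DecidableEq V] {A B : Finset V} (h : Disjoint A B) (C : Finset V) :
    adjPairs G (A ∪ B) C = adjPairs G A C + adjPairs G B C := by
  simp only [adjPairs_eq_sum_degInto, sum_union h]

lemma adjPairs_union_self [DecidableEq V] {A B : Finset V} (h : Disjoint A B) :
    adjPairs G (A ∪ B) (A ∪ B) = adjPairs G A A + 2 * adjPairs G B A + adjPairs G B B := by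
  rw [adjPairs_union_left h, adjPairs_comm A, adjPairs_comm B, adjPairs_union_left h,
    adjPairs_union_left h, adjPairs_comm A B]
  ring

lemma adjPairs_le_add_of_subset [DecidableEq V] {B B' : Finset V} (h : B ⊆ B') :
    adjPairs G B' B' ≤ adjPairs G B B + 2 * (#(B' \ B) * #B') := by
  have hcard := card_sdiff_add_card_eq_card h
  have hcross := adjPairs_le_mul (G := G) (B' \ B) B
  have hnew := adjPairs_le_mul (G := G) (B' \ B) (B' \ B)
  calc adjPairs G B' B'
      = adjPairs G B B + 2 * adjPairs G (B' \ B) B + adjPairs G (B' \ B) (B' \ B) := by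
        rw [← adjPairs_union_self disjoint_sdiff, union_sdiff_of_subset h]
    _ ≤ adjPairs G B B + 2 * (#(B' \ B) * #B') := by
        rw [← hcard]
        nlinarith

lemma sum_powersetCard_adjPairs_left_le {B : Finset V} (D : Finset V) {w : ℕ} (hw : w ≤ #B) :
    (∑ W ∈ B.powersetCard w, adjPairs G W D : ℝ) ≤
      (w : ℝ) / #B * adjPairs G B D * (#B).choose w := by
  classical
  have h := sum_card_filter_subset_le (E := G.interedges B D) (supp := fun e => {e.1}) (r := 1)
    (fun _ _ => card_singleton _) hw
  rw [pow_one] at h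
  refine le_of_eq_of_le (sum_congr rfl fun W hW => ?_) h
  have hWB := (mem_powersetCard.1 hW).1
  simp only [adjPairs]
  congr 2
  ext e
  simp only [mem_filter, SimpleGraph.mem_interedges_iff, singleton_subset_iff]
  grind

lemma sum_powersetCard_adjPairs_self_le {B : Finset V} {w : ℕ} (hw : w ≤ #B) :
    (∑ W ∈ B.powersetCard w, adjPairs G W W : ℝ) ≤
      ((w : ℝ) / #B) ^ 2 * adjPairs G B B * (#B).choose w := by
  classical
  have h := sum_card_filter_subset_le (E := G.interedges B B) (supp := fun e => {e.1, e.2})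
    (r := 2) (fun e he => card_pair (SimpleGraph.mem_interedges_iff G |>.1 he).2.2.ne) hw
  refine le_of_eq_of_le (sum_congr rfl fun W hW => ?_) h
  have hWB := (mem_powersetCard.1 hW).1
  simp only [adjPairs]
  congr 2
  ext e
  simp only [mem_filter, SimpleGraph.mem_interedges_iff, insert_subset_iff, singleton_subset_iff]
  grind

lemma exists_subset_adjPairs_le {B : Finset V} (D : Finset V) {w : ℕ} (hw : w ≤ #B) :
    ∃ W ⊆ B, #W = w ∧ 2 * (adjPairs G W D : ℝ) + adjPairs G W W ≤
      2 * ((w : ℝ) / #B * adjPairs G B D) + ((w : ℝ) / #B) ^ 2 * adjPairs G B B := by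
  classical
  have hsum : (∑ W ∈ B.powersetCard w, (2 * (adjPairs G W D : ℝ) + adjPairs G W W)) ≤
      ∑ _W ∈ B.powersetCard w,
        (2 * ((w : ℝ) / #B * adjPairs G B D) + ((w : ℝ) / #B) ^ 2 * adjPairs G B B) := by
    rw [sum_add_distrib, ← mul_sum, sum_const, card_powersetCard, nsmul_eq_mul]
    linarith [sum_powersetCard_adjPairs_left_le (G := G) D hw,
      sum_powersetCard_adjPairs_self_le (G := G) hw]
  obtain ⟨W, hW, h⟩ := exists_le_of_sum_le (powersetCard_nonempty.2 hw) hsum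
  rw [mem_powersetCard] at hW
  exact ⟨W, hW.1, hW.2, h⟩

lemma exists_superset_adjPairs_le [DecidableEq V] {B E : Finset V} (hBE : B ⊆ E) {m : ℕ}
    (hBm : #B ≤ m) (hmE : m ≤ #E) {t : ℝ} (ht : ((m : ℝ) - #B) / #(E \ B) = t) :
    ∃ B', #B' = m ∧ (adjPairs G B' B' : ℝ) ≤
      adjPairs G B B + 2 * (t * adjPairs G (E \ B) B) + t ^ 2 * adjPairs G (E \ B) (E \ B) := by
  have hm : m - #B ≤ #(E \ B) := by rw [card_sdiff_of_subset hBE]; omega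
  obtain ⟨W, hWE, hWcard, hW⟩ := exists_subset_adjPairs_le (G := G) B hm
  have hdisj : Disjoint B W := disjoint_sdiff.mono_right hWE
  refine ⟨B ∪ W, by rw [card_union_of_disjoint hdisj, hWcard]; omega, ?_⟩
  rw [adjPairs_union_self hdisj]
  rw [Nat.cast_sub hBm, ht] at hW
  push_cast
  linarith

end Adjacencies

section Thresholds

/-- The concave primitive of `1 / max 1 z` that vanishes at `1`; the container algorithm is charged
against it. -/
noncomputable def logPotential (z : ℝ) : ℝ := if z ≤ 1 then z - 1 else Real.log z

lemma sub_div_max_le_logPotential_sub {z z' : ℝ} (h : z' ≤ z) :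
    (z - z') / max 1 z ≤ logPotential z - logPotential z' := by
  unfold logPotential
  rcases le_or_gt z 1 with hz | hz
  · rw [max_eq_left hz, if_pos hz, if_pos (h.trans hz)]
    linarith
  have hz0 : 0 < z := one_pos.trans hz
  rw [max_eq_right hz.le, if_neg hz.not_ge]
  split_ifs with hz'
  · have hlog := Real.one_sub_inv_le_log_of_pos hz0
    have hinv : z⁻¹ ≤ 1 := inv_le_one_of_one_le₀ hz.le
    have heq : (z - z') / z = 1 - z' * z⁻¹ := by field_simp
    rw [heq]
    nlinarith [mul_nonneg (sub_nonneg.2 hz') (sub_nonneg.2 hinv)]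
  · have hz'0 : 0 < z' := by linarith
    have hlog := Real.one_sub_inv_le_log_of_pos (div_pos hz0 hz'0)
    rwa [Real.log_div hz0.ne' hz'0.ne', inv_div, ← div_self hz0.ne', ← sub_div] at hlog

lemma logPotential_le_log {z w : ℝ} (h : z ≤ w) (hw : 1 ≤ w) :
    logPotential z ≤ Real.log w := by
  unfold logPotential
  split_ifs with hz
  · linarith [Real.log_nonneg hw]
  · exact Real.log_le_log (by linarith) h

lemma neg_logPotential_le (z : ℝ) : -logPotential z ≤ 1 + max 0 (-z) := by
  unfold logPotential
  split_ifs with hz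
  · linarith [le_max_right 0 (-z)]
  · linarith [le_max_left 0 (-z), Real.log_nonneg (not_le.1 hz).le]

lemma exists_threshold {V : Type*} (T : Finset V) (f : V → ℕ) {q : ℝ} (hq : 0 < q)
    (hqT : q ≤ #T) : ∃ v ∈ T, q ≤ #{u ∈ T | f v ≤ f u} ∧ (#{u ∈ T | f v < f u} : ℝ) < q := by
  classical
  have exists_min {S : Finset V} (hS : q ≤ #S) : ∃ v ∈ S, ∀ u ∈ S, f v ≤ f u :=
    exists_min_image S f (card_pos.1 (by exact_mod_cast hq.trans_le hS))
  obtain ⟨v₀, hv₀, hmin⟩ := exists_min hqT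
  have hne : {v ∈ T | q ≤ #{u ∈ T | f v ≤ f u}}.Nonempty :=
    ⟨v₀, mem_filter.2 ⟨hv₀, by rwa [filter_true_of_mem hmin]⟩⟩
  obtain ⟨v, hv, hmax⟩ := exists_max_image _ f hne
  refine ⟨v, (mem_filter.1 hv).1, (mem_filter.1 hv).2, not_le.1 fun hcard => ?_⟩
  obtain ⟨v', hv', hmin'⟩ := exists_min hcard
  obtain ⟨hv'T, hlt⟩ := mem_filter.1 hv'
  refine hlt.not_ge (hmax v' (mem_filter.2 ⟨hv'T, hcard.trans ?_⟩))
  exact_mod_cast card_le_card fun u hu => mem_filter.2 ⟨(mem_filter.1 hu).1, hmin' u hu⟩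

lemma le_sum_of_thresholds (D : ℕ → ℕ) (m d : ℕ) (h : d ≤ D m) :
    d ≤ ∑ k ∈ range (m + 1), if k = 0 ∨ D (k - 1) < d then D k else 0 := by
  classical
  have hex : ∃ k, d ≤ D k := ⟨m, h⟩
  obtain ⟨k, hk, hkm, hmin⟩ : ∃ k, d ≤ D k ∧ k ≤ m ∧ (k = 0 ∨ D (k - 1) < d) := by
    refine ⟨Nat.find hex, Nat.find_spec hex, Nat.find_min' hex h, ?_⟩
    exact (Nat.eq_zero_or_pos _).imp_right fun h0 =>
      not_le.1 (Nat.find_min hex (Nat.sub_lt h0 one_pos))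
  calc d ≤ if k = 0 ∨ D (k - 1) < d then D k else 0 := by rwa [if_pos hmin]
    _ ≤ _ := single_le_sum (f := fun k => if k = 0 ∨ D (k - 1) < d then D k else 0)
        (fun _ _ => Nat.zero_le _) (mem_range.2 (by omega))

lemma adjPairs_le_sum_thresholds {V : Type*} {G : SimpleGraph V} {A C : Finset V} (D : ℕ → ℕ)
    (m : ℕ) (h : ∀ u ∈ A, degInto G C u ≤ D m) :
    adjPairs G A C ≤ ∑ k ∈ range (m + 1), #{u ∈ A | k = 0 ∨ D (k - 1) < degInto G C u} * D k := by
  calc adjPairs G A C = ∑ u ∈ A, degInto G C u := adjPairs_eq_sum_degInto A C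
    _ ≤ ∑ u ∈ A, ∑ k ∈ range (m + 1), if k = 0 ∨ D (k - 1) < degInto G C u then D k else 0 :=
        sum_le_sum fun u hu => le_sum_of_thresholds D m _ (h u hu)
    _ = ∑ k ∈ range (m + 1), ∑ u ∈ A, if k = 0 ∨ D (k - 1) < degInto G C u then D k else 0 :=
        sum_comm
    _ = _ := sum_congr rfl fun k _ => by rw [← sum_filter, sum_const, smul_eq_mul]

end Thresholds

section Containers

variable {V : Type*} {G : SimpleGraph V}

open Classical in
/-- One step of the container algorithm: `(v, true)` picks `v` and removes its neighbours from `C`,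
`(v, false)` drops `v` and removes the vertices that have more neighbours in `C` than `v` has. -/
noncomputable def shrink (G : SimpleGraph V) (C : Finset V) (a : V × Bool) : Finset V :=
  if a.2 then {u ∈ C | ¬ G.Adj a.1 u} else {u ∈ C | degInto G C u ≤ degInto G C a.1}

lemma card_shrink_pick (C : Finset V) (v : V) :
    #(shrink G C (v, true)) + degInto G C v = #C := by
  classical
  rw [shrink, if_pos rfl, degInto, add_comm, card_filter_add_card_filter_not]

lemma shrink_drop (C : Finset V) (v : V) :
    shrink G C (v, false) = {u ∈ C | degInto G C u ≤ degInto G C v} := by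
  simp [shrink]

lemma card_shrink_drop (C : Finset V) (v : V) :
    #(shrink G C (v, false)) + #{u ∈ C | degInto G C v < degInto G C u} = #C := by
  simp only [shrink_drop, ← not_le]
  exact card_filter_add_card_filter_not _

lemma card_inter_shrink_pick [DecidableEq V] (B C : Finset V) (v : V) :
    #(B ∩ C) ≤ #(B ∩ shrink G C (v, true)) + degInto G B v := by
  classical
  rw [shrink, if_pos rfl, degInto]
  refine (card_le_card fun u hu => ?_).trans (card_union_le _ _)
  simp only [mem_inter, mem_union, mem_filter] at *
  tauto

lemma card_inter_shrink_drop [DecidableEq V] (B C : Finset V) (v : V) :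
    #(B ∩ C) = #(B ∩ shrink G C (v, false)) + #{u ∈ B ∩ C | degInto G C v < degInto G C u} := by
  simp only [shrink_drop, inter_filter, ← not_le]
  exact (card_filter_add_card_filter_not (s := B ∩ C) fun u => degInto G C u ≤ degInto G C v).symm

variable [Fintype V]

/-- The container determined by a word of picked and dropped vertices, the fingerprint. -/
noncomputable def container (G : SimpleGraph V) (w : List (V × Bool)) : Finset V :=
  w.foldl (shrink G) univ

@[simp] lemma container_nil : container G [] = univ := rfl

lemma container_concat (w : List (V × Bool)) (a : V × Bool) :
    container G (w ++ [a]) = shrink G (container G w) a := by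
  simp [container]

/-- `T` is captured at density `ρ` and sample size `s` if, for some `δ ≥ κ`, two words over `T` of
total length at most `δ / c` have containers whose intersection has density at most `ρ - δ` in the
graph and yet contains at least `(ρ - δ / 2) s` elements of `T`. -/
def IsCaptured [DecidableEq V] (G : SimpleGraph V) (ρ κ c s : ℝ) (T : Finset V) : Prop :=
  ∃ w₁ w₂ : List (V × Bool), (∀ a ∈ w₁, a.1 ∈ T) ∧ (∀ a ∈ w₂, a.1 ∈ T) ∧ ∃ δ, κ ≤ δ ∧
    c * (w₁.length + w₂.length) ≤ δ ∧ (container G w₁ ∩ container G w₂).dens ≤ ρ - δ ∧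
    (ρ - δ / 2) * s ≤ #(T ∩ (container G w₁ ∩ container G w₂))

lemma IsCaptured.mono [DecidableEq V] {ρ κ c s : ℝ} {T T' : Finset V} (h : T ⊆ T')
    (hT : IsCaptured G ρ κ c s T) : IsCaptured G ρ κ c s T' := by
  obtain ⟨w₁, w₂, h₁, h₂, δ, hκ, hc, hdens, hcard⟩ := hT
  refine ⟨w₁, w₂, fun a ha => h (h₁ a ha), fun a ha => h (h₂ a ha), δ, hκ, hc, hdens,
    hcard.trans ?_⟩
  exact_mod_cast card_le_card (inter_subset_inter_right h)

end Containers

/-- The parameters of the container algorithm in a graph all of whose vertex sets of density `ρ`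
should span at least `ε N²` edges: the sample spans at most `2 μ s²` edges, the algorithm is run at
the scales `ρ / 2 ^ i` for `i ≤ I`, and `A ≈ 2 ^ α` is its gain-to-cost ratio. -/
structure ContainerParams where
  (ρ ε μ A : ℝ)
  (I α : ℕ)
  ρ_pos : 0 < ρ
  ρ_le_one : ρ ≤ 1
  ε_pos : 0 < ε
  ε_le : ε ≤ ρ ^ 2
  μ_pos : 0 < μ
  le_two_pow_I : 8 * ρ ^ 2 ≤ ε * 2 ^ I
  log_le_A : 20 * (Real.log (2 ^ I / ρ) + 1) ≤ A
  A_le_two_pow : 8 * A ≤ 2 ^ α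
  two_pow_le_A : 2 ^ α ≤ 16 * A
  μ_le : 20000 * A ^ 2 * (I + α + 1) * μ ≤ ε
  cost_le : 8 * μ / ρ ≤ ρ / 2 ^ (I + α + 1)

namespace ContainerParams

variable (P : ContainerParams)

/-- The precision of the `i`-th run of the container algorithm. -/
noncomputable def scale (i : ℕ) : ℝ := P.ρ / 2 ^ i

/-- The smallest cost of a letter of a word. -/
noncomputable def unitCost : ℝ := 8 * P.μ / P.ρ

/-- The gain-to-cost ratio that the `i`-th run requires of a letter when the container has
density `x`. -/
noncomputable def rate (i : ℕ) (x : ℝ) : ℝ := P.A * max 1 ((x - P.ρ) / P.scale i)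

/-- The budget released in the `i`-th run when the density of the container falls from `1`
to `x`. -/
noncomputable def budget (i : ℕ) (x : ℝ) : ℝ :=
  P.scale i / P.A *
    (logPotential ((1 - P.ρ) / P.scale i) - logPotential ((x - P.ρ) / P.scale i))

lemma scale_pos (i : ℕ) : 0 < P.scale i := div_pos P.ρ_pos (by positivity)

lemma scale_zero : P.scale 0 = P.ρ := by simp [scale]

lemma scale_succ (i : ℕ) : P.scale (i + 1) = P.scale i / 2 := by
  rw [scale, scale, pow_succ, div_div]

lemma scale_anti {i j : ℕ} (h : i ≤ j) : P.scale j ≤ P.scale i :=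
  div_le_div_of_nonneg_left P.ρ_pos.le (by positivity) (pow_le_pow_right₀ one_le_two h)

lemma unitCost_pos : 0 < P.unitCost := div_pos (mul_pos (by norm_num) P.μ_pos) P.ρ_pos

lemma unitCost_le {k : ℕ} (hk : k ≤ P.I + P.α + 1) : P.unitCost ≤ P.scale k :=
  P.cost_le.trans (P.scale_anti hk)

lemma one_le_two_pow_div : 1 ≤ 2 ^ P.I / P.ρ := by
  rw [one_le_div P.ρ_pos]
  exact P.ρ_le_one.trans (one_le_pow₀ one_le_two)

lemma twenty_le_A : 20 ≤ P.A := by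
  linarith [P.log_le_A, Real.log_nonneg P.one_le_two_pow_div]

lemma A_pos : 0 < P.A := by linarith [P.twenty_le_A]

lemma rate_pos (i : ℕ) (x : ℝ) : 0 < P.rate i x :=
  mul_pos P.A_pos (lt_max_of_lt_left one_pos)

lemma three_le_I : 3 ≤ P.I := by
  have h8 : (2 : ℝ) ^ 3 ≤ 2 ^ P.I := by
    refine le_of_mul_le_mul_left ?_ P.ε_pos
    linarith [P.le_two_pow_I, P.ε_le]
  exact (pow_le_pow_iff_right₀ one_lt_two).1 h8

lemma rate_eq_of_le {i : ℕ} {x : ℝ} (h : x - P.ρ ≤ P.scale i) : P.rate i x = P.A := by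
  rw [rate, max_eq_left ((div_le_one (P.scale_pos i)).2 h), mul_one]

lemma rate_eq_of_lt {i : ℕ} {x : ℝ} (h : P.scale i < x - P.ρ) :
    P.rate i x = P.A * ((x - P.ρ) / P.scale i) := by
  rw [rate, max_eq_right ((one_le_div (P.scale_pos i)).2 h.le)]

lemma A_mul_scale_le (i : ℕ) : P.A * P.scale (i + P.α + 1) ≤ P.scale i / 16 := by
  have hscale : P.scale (i + P.α + 1) = P.scale i / 2 ^ (P.α + 1) := by
    rw [scale, scale, div_div, ← pow_add, add_assoc]
  rw [hscale, mul_div_left_comm, div_eq_mul_inv _ (16 : ℝ)]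
  refine mul_le_mul_of_nonneg_left ?_ (P.scale_pos i).le
  rw [div_le_iff₀ (by positivity), pow_succ]
  linarith [P.A_le_two_pow]

lemma sq_A_mul_le {i : ℕ} (hi : i ≤ P.I) :
    P.A ^ 2 * (i + P.α + 1) * P.μ ≤ P.ε / 20000 := by
  have hmono : P.A ^ 2 * (i + P.α + 1) * P.μ ≤ P.A ^ 2 * (P.I + P.α + 1) * P.μ := by
    have := P.μ_pos
    gcongr
  linarith [P.μ_le]

lemma sum_scale_div_scale_le (i : ℕ) :
    ∑ k ∈ range (i + P.α + 1), P.scale i / P.scale (k + 1) ≤ 64 * P.A := by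
  have hratio : ∀ k ∈ range (i + P.α + 1), P.scale i / P.scale (k + 1) = 2 / 2 ^ i * 2 ^ k := by
    intro k _
    have := P.ρ_pos
    rw [scale, scale, pow_succ]
    field_simp
  calc ∑ k ∈ range (i + P.α + 1), P.scale i / P.scale (k + 1)
      = 2 / 2 ^ i * ∑ k ∈ range (i + P.α + 1), 2 ^ k := by rw [sum_congr rfl hratio, ← mul_sum]
    _ ≤ 2 / 2 ^ i * 2 ^ (i + P.α + 1) := by
        gcongr
        rw [geom_sum_eq (by norm_num)]
        norm_num
    _ = 4 * 2 ^ P.α := by rw [pow_succ, pow_add]; field_simp; norm_num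
    _ ≤ 64 * P.A := by linarith [P.two_pow_le_A]

lemma le_budget_sub {i : ℕ} {q x x' : ℝ} (hq : 0 ≤ q) (h : P.rate i x * q ≤ x - x') :
    q ≤ P.budget i x' - P.budget i x := by
  have hA := P.A_pos
  have hscale := P.scale_pos i
  have hx : x' ≤ x := by linarith [mul_nonneg (P.rate_pos i x).le hq]
  have hpot := sub_div_max_le_logPotential_sub
    (z := (x - P.ρ) / P.scale i) (z' := (x' - P.ρ) / P.scale i) (by gcongr)
  calc q ≤ (x - x') / P.rate i x := by rwa [le_div_iff₀ (P.rate_pos i x), mul_comm]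
    _ = P.scale i / P.A * (((x - P.ρ) / P.scale i - (x' - P.ρ) / P.scale i) /
        max 1 ((x - P.ρ) / P.scale i)) := by
      rw [rate, ← sub_div, sub_sub_sub_cancel_right]
      field_simp [(lt_max_of_lt_left one_pos : 0 < max 1 ((x - P.ρ) / P.scale i)).ne']
    _ ≤ P.scale i / P.A *
        (logPotential ((x - P.ρ) / P.scale i) - logPotential ((x' - P.ρ) / P.scale i)) := by
      gcongr
    _ = P.budget i x' - P.budget i x := by rw [budget, budget]; ring

lemma budget_le {i : ℕ} (hi : i ≤ P.I) (x : ℝ) :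
    P.budget i x ≤ P.scale i / 20 + max 0 (P.ρ - x) / 20 := by
  have hscale := P.scale_pos i
  have hA := P.A_pos
  have hstart : logPotential ((1 - P.ρ) / P.scale i) ≤ Real.log (2 ^ P.I / P.ρ) := by
    refine logPotential_le_log ?_ P.one_le_two_pow_div
    have hinv : (2 : ℝ) ^ P.I / P.ρ = 1 / P.scale P.I := by rw [scale, one_div_div]
    rw [hinv]
    exact div_le_div₀ zero_le_one (by linarith [P.ρ_pos]) (P.scale_pos _) (P.scale_anti hi)
  have hend : -logPotential ((x - P.ρ) / P.scale i) ≤ 1 + max 0 (P.ρ - x) / P.scale i := by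
    refine (neg_logPotential_le _).trans_eq ?_
    rw [← neg_div, neg_sub, ← max_div_div_right hscale.le, zero_div]
  calc P.budget i x
      ≤ P.scale i / P.A * (P.A / 20 + max 0 (P.ρ - x) / P.scale i) := by
        rw [budget]
        gcongr
        linarith [P.log_le_A]
    _ = P.scale i / 20 + max 0 (P.ρ - x) / P.A := by field_simp
    _ ≤ P.scale i / 20 + max 0 (P.ρ - x) / 20 := by gcongr; exact P.twenty_le_A

end ContainerParams

/-- A sparse vertex set `J` with about `ρ s` elements in a graph `G`, together with parameters for
the container algorithm, such that `J` is not captured. -/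
structure SparseSetting (V : Type*) [Fintype V] [DecidableEq V] extends ContainerParams where
  G : SimpleGraph V
  J : Finset V
  s : ℝ
  s_pos : 0 < s
  card_V : 4 ≤ toContainerParams.scale I * Fintype.card V
  sparse : (adjPairs G J J : ℝ) ≤ 4 * μ * s ^ 2
  le_card_J : (ρ - toContainerParams.scale I / 20) * s ≤ #J
  card_J_le : #J ≤ ρ * s
  not_isCaptured :
    ¬ IsCaptured G ρ (toContainerParams.scale I) toContainerParams.unitCost s J

namespace SparseSetting

variable {V : Type*} [Fintype V] [DecidableEq V]

lemma card_V_pos (X : SparseSetting V) : (0 : ℝ) < Fintype.card V :=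
  pos_of_mul_pos_right (by linarith [X.card_V]) (X.scale_pos X.I).le

variable (X : SparseSetting V)

lemma four_le_scale_mul {i : ℕ} (hi : i ≤ X.I) :
    4 ≤ X.scale i * Fintype.card V :=
  X.card_V.trans (mul_le_mul_of_nonneg_right (X.scale_anti hi) X.card_V_pos.le)

/-- The word `w` is affordable in the `i`-th run: the decrease of the density of the container pays
for the total cost `K` of its letters, which bounds the loss in `J`. -/
def Affordable (i : ℕ) (w : List (V × Bool)) : Prop :=
  (∀ a ∈ w, a.1 ∈ X.J) ∧ ∃ K : ℝ, X.unitCost * w.length ≤ K ∧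
    (X.ρ - X.scale X.I / 20 - K) * X.s ≤ #(X.J ∩ container X.G w) ∧
    K ≤ X.budget i (container X.G w).dens

lemma affordable_nil (i : ℕ) : X.Affordable i [] := by
  have : Nonempty V := Fintype.card_pos_iff.1 (by exact_mod_cast X.card_V_pos)
  refine ⟨by simp, 0, by simp, ?_, ?_⟩
  · simpa using X.le_card_J
  · simp [ContainerParams.budget]

variable {X}

lemma Affordable.concat {i : ℕ} {w : List (V × Bool)} (hw : X.Affordable i w) {a : V × Bool}
    (ha : a.1 ∈ X.J) {q : ℝ} (hq : X.unitCost ≤ q)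
    (hloss : (#(X.J ∩ container X.G w) : ℝ) - #(X.J ∩ shrink X.G (container X.G w) a) ≤ q * X.s)
    (hgain : X.rate i (container X.G w).dens * q * Fintype.card V ≤
      #(container X.G w) - #(shrink X.G (container X.G w) a)) :
    X.Affordable i (w ++ [a]) := by
  obtain ⟨hJ, K, hlen, hcard, hK⟩ := hw
  refine ⟨?_, K + q, ?_, ?_, ?_⟩
  · intro b hb
    rcases List.mem_append.1 hb with hb | hb
    exacts [hJ b hb, List.mem_singleton.1 hb ▸ ha]
  · rw [List.length_append, List.length_singleton]
    push_cast
    linarith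
  · rw [container_concat]
    linarith
  · rw [container_concat]
    rw [← le_div_iff₀ X.card_V_pos, sub_div, ← nnratCast_dens, ← nnratCast_dens] at hgain
    linarith [X.le_budget_sub (X.unitCost_pos.le.trans hq) hgain]

lemma lt_dens_container {w : List (V × Bool)} (hJ : ∀ a ∈ w, a.1 ∈ X.J) {δ : ℝ}
    (hδ : X.scale X.I ≤ δ) (hlen : X.unitCost * w.length ≤ δ)
    (hcard : (X.ρ - δ / 2) * X.s ≤ #(X.J ∩ container X.G w)) :
    X.ρ - δ < (container X.G w).dens := by
  by_contra! hdens
  refine X.not_isCaptured ⟨w, [], hJ, by simp, δ, hδ, by simpa using hlen, ?_, ?_⟩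
  · rwa [container_nil, inter_univ]
  · rwa [container_nil, inter_univ]

lemma lt_dens_inter {w₁ w₂ : List (V × Bool)} (hJ₁ : ∀ a ∈ w₁, a.1 ∈ X.J)
    (hJ₂ : ∀ a ∈ w₂, a.1 ∈ X.J) {δ η₁ η₂ : ℝ} (hδ : X.scale X.I ≤ δ)
    (hlen : X.unitCost * w₁.length + X.unitCost * w₂.length ≤ δ) (hη : η₁ + η₂ ≤ δ / 2)
    (hcard₁ : (X.ρ - η₁) * X.s ≤ #(X.J ∩ container X.G w₁))
    (hcard₂ : (X.ρ - η₂) * X.s ≤ #(X.J ∩ container X.G w₂)) :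
    X.ρ - δ < (container X.G w₁ ∩ container X.G w₂).dens := by
  by_contra! hdens
  refine X.not_isCaptured ⟨w₁, w₂, hJ₁, hJ₂, δ, hδ, by rwa [mul_add], hdens, ?_⟩
  have hunion : #((X.J ∩ container X.G w₁) ∪ (X.J ∩ container X.G w₂)) ≤ #X.J :=
    card_le_card (union_subset inter_subset_left inter_subset_left)
  have hinter := card_union_add_card_inter (X.J ∩ container X.G w₁) (X.J ∩ container X.G w₂)
  rw [← inter_inter_distrib_left] at hinter
  have hsum : (#(X.J ∩ container X.G w₁) : ℝ) + #(X.J ∩ container X.G w₂) ≤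
      #X.J + #(X.J ∩ (container X.G w₁ ∩ container X.G w₂)) := by
    exact_mod_cast hinter ▸ Nat.add_le_add_right hunion _
  have hηs := mul_le_mul_of_nonneg_right hη X.s_pos.le
  linarith [X.card_J_le]

lemma Affordable.lt_dens {i : ℕ} (hi : i ≤ X.I) {w : List (V × Bool)} (hw : X.Affordable i w) :
    X.ρ - X.scale i < (container X.G w).dens := by
  obtain ⟨hJ, K, hlen, hcard, hK⟩ := hw
  by_contra! hdens
  have hpos := X.scale_pos i
  have hscale := X.scale_anti hi
  have hbudget := hK.trans (X.budget_le hi _)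
  rw [max_eq_right (by linarith)] at hbudget
  refine (lt_dens_container hJ (δ := X.ρ - (container X.G w).dens) (by linarith) (by linarith)
    ?_).ne (sub_sub_cancel _ _)
  refine le_trans (mul_le_mul_of_nonneg_right ?_ X.s_pos.le) hcard
  linarith

lemma Affordable.bounds {i : ℕ} (hi : i ≤ X.I) {w : List (V × Bool)} (hw : X.Affordable i w) :
    X.unitCost * w.length ≤ X.scale i / 10 ∧
      (X.ρ - X.scale i / 5) * X.s ≤ #(X.J ∩ container X.G w) := by
  have hpos := X.scale_pos i
  have hdens := hw.lt_dens hi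
  obtain ⟨-, K, hlen, hcard, hK⟩ := hw
  have hmax : max 0 (X.ρ - (container X.G w).dens) ≤ X.scale i :=
    max_le hpos.le (by linarith)
  have hbudget := hK.trans (X.budget_le hi _)
  have hscale := X.scale_anti hi
  refine ⟨by linarith, le_trans (mul_le_mul_of_nonneg_right ?_ X.s_pos.le) hcard⟩
  linarith

end SparseSetting

section LowPart

variable {V : Type*} [Fintype V] {G : SimpleGraph V}

/-- The number of neighbours of `v` in the container of the word `w`. -/
noncomputable def containerDegree (G : SimpleGraph V) (w : List (V × Bool)) (v : V) : ℕ :=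
  degInto G (container G w) v

/-- The part of the container of `w` that remains after dropping `v`. -/
noncomputable def lowPart (G : SimpleGraph V) (w : List (V × Bool)) (v : V) : Finset V :=
  container G (w ++ [(v, false)])

lemma mem_lowPart {w : List (V × Bool)} {u v : V} :
    u ∈ lowPart G w v ↔
      u ∈ container G w ∧ containerDegree G w u ≤ containerDegree G w v := by
  rw [lowPart, container_concat, shrink_drop, mem_filter, containerDegree, containerDegree]

lemma lowPart_subset (w : List (V × Bool)) (v : V) : lowPart G w v ⊆ container G w :=
  fun _ hu => (mem_lowPart.1 hu).1

lemma card_lowPart (w : List (V × Bool)) (v : V) :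
    #(lowPart G w v) + #{u ∈ container G w | containerDegree G w v < containerDegree G w u} =
      #(container G w) := by
  rw [lowPart, container_concat]
  exact card_shrink_drop _ _

lemma card_inter_lowPart [DecidableEq V] (B : Finset V) (w : List (V × Bool)) (v : V) :
    #(B ∩ container G w) = #(B ∩ lowPart G w v) +
      #{u ∈ B ∩ container G w | containerDegree G w v < containerDegree G w u} := by
  rw [lowPart, container_concat]
  exact card_inter_shrink_drop _ _ _

end LowPart

namespace SparseSetting

variable {V : Type*} [Fintype V] [DecidableEq V] {X : SparseSetting V}

/-- The `i`-th run of the container algorithm is stuck at `w`: every further letter costs more than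
the shrinking of the container pays for. -/
def IsStuck (X : SparseSetting V) (i : ℕ) (w : List (V × Bool)) : Prop :=
  X.Affordable i w ∧ ∀ a : V × Bool, a.1 ∈ X.J → ∀ q, X.unitCost ≤ q →
    (#(X.J ∩ container X.G w) : ℝ) - #(X.J ∩ shrink X.G (container X.G w) a) ≤ q * X.s →
    (#(container X.G w) : ℝ) - #(shrink X.G (container X.G w) a) <
      X.rate i (container X.G w).dens * q * Fintype.card V

lemma exists_isStuck (X : SparseSetting V) (i : ℕ) : ∃ w, X.IsStuck i w := by
  obtain ⟨w, hw⟩ := exists_minimalFor_of_wellFoundedLT (X.Affordable i)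
    (fun w => #(container X.G w)) ⟨[], X.affordable_nil i⟩
  refine ⟨w, hw.prop, fun a ha q hq hloss => not_le.1 fun hgain => ?_⟩
  have hpos : 0 < X.rate i (container X.G w).dens * q * Fintype.card V :=
    mul_pos (mul_pos (X.rate_pos _ _) (X.unitCost_pos.trans_le hq)) X.card_V_pos
  have hlt : #(shrink X.G (container X.G w) a) < #(container X.G w) := by
    exact_mod_cast sub_pos.1 (hpos.trans_le hgain)
  rw [← container_concat] at hlt
  exact hw.not_lt (hw.prop.concat ha hq hloss hgain) hlt

lemma IsStuck.degree_lt {i : ℕ} {w : List (V × Bool)} (h : X.IsStuck i w) {D : ℕ} {y : ℝ}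
    (hy : 0 < y) (hyρ : y ≤ X.ρ / 2)
    (hD : y * X.s ≤ #{v ∈ X.J ∩ container X.G w | D ≤ containerDegree X.G w v}) :
    (D : ℝ) < X.rate i (container X.G w).dens * (4 * X.μ / y) * Fintype.card V := by
  set T := {v ∈ X.J ∩ container X.G w | D ≤ containerDegree X.G w v}
  have hTJ : T ⊆ X.J := (filter_subset _ _).trans inter_subset_left
  have hys : 0 < y * X.s := mul_pos hy X.s_pos
  have hTne : T.Nonempty := card_pos.1 (by exact_mod_cast hys.trans_le hD)
  obtain ⟨v, hv, hvJ⟩ := exists_degInto_mul_card_le (G := X.G) hTne X.J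
  have hdeg : (degInto X.G X.J v : ℝ) ≤ 4 * X.μ / y * X.s := by
    rw [div_mul_eq_mul_div, le_div_iff₀ hy]
    refine le_of_mul_le_mul_right ?_ X.s_pos
    calc (degInto X.G X.J v : ℝ) * y * X.s ≤ degInto X.G X.J v * #T := by
          rw [mul_assoc]; gcongr
      _ ≤ adjPairs X.G X.J X.J := by exact_mod_cast hvJ.trans (adjPairs_mono hTJ subset_rfl)
      _ ≤ 4 * X.μ * X.s * X.s := X.sparse.trans_eq (by ring)
  have hcost : X.unitCost ≤ 4 * X.μ / y := by
    rw [ContainerParams.unitCost, div_le_div_iff₀ X.ρ_pos hy]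
    linarith [mul_le_mul_of_nonneg_left hyρ X.μ_pos.le]
  have hloss : (#(X.J ∩ container X.G w) : ℝ) ≤
      #(X.J ∩ shrink X.G (container X.G w) (v, true)) + degInto X.G X.J v := by
    exact_mod_cast card_inter_shrink_pick X.J (container X.G w) v
  have hgain : (#(shrink X.G (container X.G w) (v, true)) : ℝ) + containerDegree X.G w v =
      #(container X.G w) := by
    exact_mod_cast card_shrink_pick (container X.G w) v
  have hDv : (D : ℝ) ≤ containerDegree X.G w v := by exact_mod_cast (mem_filter.1 hv).2
  linarith [h.2 (v, true) (hTJ hv) _ hcost (by linarith)]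

lemma IsStuck.card_above_lt {i : ℕ} {w : List (V × Bool)} (h : X.IsStuck i w) {v : V}
    (hv : v ∈ X.J) {y : ℝ} (hy : X.unitCost ≤ y)
    (hloss : #{u ∈ X.J ∩ container X.G w | containerDegree X.G w v < containerDegree X.G w u} ≤
      y * X.s) :
    (#{u ∈ container X.G w | containerDegree X.G w v < containerDegree X.G w u} : ℝ) <
      X.rate i (container X.G w).dens * y * Fintype.card V := by
  have hinter := congrArg (Nat.cast (R := ℝ)) (card_inter_lowPart (G := X.G) X.J w v)
  have hcard := congrArg (Nat.cast (R := ℝ)) (card_lowPart (G := X.G) w v)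
  push_cast [lowPart, container_concat] at hinter hcard
  linarith [h.2 (v, false) hv y hy (by linarith)]

/-- The outcome of the `i`-th run: a word `w` together with vertices `v k` of `J` whose degrees into
the container of `w` are small, and are exceeded by few vertices of the container. -/
structure Terminal (X : SparseSetting V) (i : ℕ) (w : List (V × Bool)) (v : ℕ → V) : Prop where
  affordable : X.Affordable i w
  mem : ∀ k ≤ i + X.α, v k ∈ X.J
  degree_le : ∀ k ≤ i + X.α,
    containerDegree X.G w (v k) ≤ containerDegree X.G w (v (i + X.α))
  card_above_J_lt : ∀ k ≤ i + X.α,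
    (#{u ∈ X.J ∩ container X.G w | containerDegree X.G w (v k) < containerDegree X.G w u} : ℝ) <
      X.scale (k + 1) * X.s
  degree_lt : ∀ k ≤ i + X.α, (containerDegree X.G w (v k) : ℝ) <
    X.rate i (container X.G w).dens * (4 * X.μ / X.scale (k + 1)) * Fintype.card V
  card_above_lt : ∀ k ≤ i + X.α,
    (#{u ∈ container X.G w | containerDegree X.G w (v k) < containerDegree X.G w u} : ℝ) <
      X.rate i (container X.G w).dens * X.scale (k + 1) * Fintype.card V

lemma exists_terminal (X : SparseSetting V) {i : ℕ} (hi₁ : 1 ≤ i) (hi : i ≤ X.I) :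
    ∃ w v, X.Terminal i w v := by
  obtain ⟨w, hw⟩ := X.exists_isStuck i
  have hhalf {j : ℕ} (hj : 1 ≤ j) : X.scale j ≤ X.ρ / 2 := by
    rw [← X.scale_zero, ← X.scale_succ]
    exact X.scale_anti hj
  have hcard (k : ℕ) : X.scale (k + 1) * X.s ≤ #(X.J ∩ container X.G w) := by
    refine le_trans (mul_le_mul_of_nonneg_right ?_ X.s_pos.le) (hw.1.bounds hi).2
    linarith [hhalf (Nat.succ_pos k), hhalf hi₁, X.ρ_pos]
  choose v hv hle hlt using fun k => exists_threshold (X.J ∩ container X.G w)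
    (containerDegree X.G w) (mul_pos (X.scale_pos (k + 1)) X.s_pos) (hcard k)
  have hvJ (k : ℕ) : v k ∈ X.J := (mem_inter.1 (hv k)).1
  refine ⟨w, v, hw.1, fun k _ => hvJ k, fun k hk => not_lt.1 fun hdeg => ?_, fun k _ => hlt k,
    fun k _ => hw.degree_lt (X.scale_pos _) (hhalf (Nat.succ_pos k)) (hle k),
    fun k hk => hw.card_above_lt (hvJ k) (X.unitCost_le (by omega)) (hlt k).le⟩
  have hsub : (#{u ∈ X.J ∩ container X.G w | containerDegree X.G w (v k) ≤
      containerDegree X.G w u} : ℝ) ≤ #{u ∈ X.J ∩ container X.G w |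
      containerDegree X.G w (v (i + X.α)) < containerDegree X.G w u} := by
    gcongr
  have hscale : X.scale (i + X.α + 1) * X.s ≤ X.scale (k + 1) * X.s :=
    mul_le_mul_of_nonneg_right (X.scale_anti (by omega)) X.s_pos.le
  linarith [hle k, hlt (i + X.α)]

end SparseSetting

/-- The conclusion of the container argument: some vertex set of density at least `ρ` spans fewer
than `ε N²` edges. -/
def HasSparseSet {V : Type*} [Fintype V] (G : SimpleGraph V) (ρ ε : ℝ) : Prop :=
  ∃ B : Finset V, ρ * Fintype.card V ≤ #B ∧
    (adjPairs G B B : ℝ) < 2 * ε * (Fintype.card V : ℝ) ^ 2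

namespace SparseSetting

variable {V : Type*} [Fintype V] [DecidableEq V] {X : SparseSetting V} {i k : ℕ}
  {w : List (V × Bool)} {v : ℕ → V}

lemma Terminal.mem_of_mem_lowPart_word (h : X.Terminal i w v) (hk : k ≤ i + X.α) :
    ∀ a ∈ w ++ [(v k, false)], a.1 ∈ X.J := by
  intro a ha
  rcases List.mem_append.1 ha with ha | ha
  exacts [h.affordable.1 a ha, List.mem_singleton.1 ha ▸ h.mem k hk]

lemma Terminal.unitCost_mul_length_le (h : X.Terminal i w v) (hi : i ≤ X.I) (k : ℕ) :
    X.unitCost * (w ++ [(v k, false)]).length ≤ X.scale i / 4 := by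
  have hcost := X.unitCost_le (k := i + X.α + 1) (by omega)
  have hlast : 20 * X.scale (i + X.α + 1) ≤ X.scale i / 16 :=
    (mul_le_mul_of_nonneg_right X.twenty_le_A (X.scale_pos _).le).trans (X.A_mul_scale_le i)
  rw [List.length_append, List.length_singleton]
  push_cast
  linarith [(h.affordable.bounds hi).1, X.scale_pos i]

lemma Terminal.le_card_inter_lowPart (h : X.Terminal i w v) (hi : i ≤ X.I) (hk : k ≤ i + X.α) :
    (X.ρ - (X.scale i / 5 + X.scale (k + 1))) * X.s ≤ #(X.J ∩ lowPart X.G w (v k)) := by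
  have hinter : (#(X.J ∩ container X.G w) : ℝ) = #(X.J ∩ lowPart X.G w (v k)) +
      #{u ∈ X.J ∩ container X.G w |
        containerDegree X.G w (v k) < containerDegree X.G w u} := by
    exact_mod_cast card_inter_lowPart X.J w (v k)
  linarith [(h.affordable.bounds hi).2, h.card_above_J_lt k hk]

lemma Terminal.adjPairs_le (h : X.Terminal i w v) {A : Finset V}
    (hA : A ⊆ lowPart X.G w (v (i + X.α))) {b : ℕ → ℝ}
    (hb : ∀ k ≤ i + X.α, (#{u ∈ A | k = 0 ∨
      containerDegree X.G w (v (k - 1)) < containerDegree X.G w u} : ℝ) ≤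
        b k * Fintype.card V) :
    (adjPairs X.G A (container X.G w) : ℝ) ≤
      (∑ k ∈ range (i + X.α + 1), b k / X.scale (k + 1)) *
        (4 * X.μ * X.rate i (container X.G w).dens * (Fintype.card V : ℝ) ^ 2) := by
  have hsum : (adjPairs X.G A (container X.G w) : ℝ) ≤ ∑ k ∈ range (i + X.α + 1),
      (#{u ∈ A | k = 0 ∨ containerDegree X.G w (v (k - 1)) < containerDegree X.G w u} : ℝ) *
        containerDegree X.G w (v k) := by
    exact_mod_cast adjPairs_le_sum_thresholds (fun k => containerDegree X.G w (v k)) (i + X.α)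
      fun u hu => (mem_lowPart.1 (hA hu)).2
  refine hsum.trans ?_
  rw [sum_mul]
  refine sum_le_sum fun k hk => ?_
  have hk : k ≤ i + X.α := Nat.lt_succ_iff.1 (mem_range.1 hk)
  refine (mul_le_mul (hb k hk) (h.degree_lt k hk).le (Nat.cast_nonneg _)
    ((Nat.cast_nonneg _).trans (hb k hk))).trans_eq ?_
  ring

lemma Terminal.card_above_le (h : X.Terminal i w v) (hk : k ≤ i + X.α) :
    (#{u ∈ container X.G w | k = 0 ∨
      containerDegree X.G w (v (k - 1)) < containerDegree X.G w u} : ℝ) ≤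
      X.rate i (container X.G w).dens * X.scale k * Fintype.card V := by
  rcases k with _ | k
  · have hpos := X.scale_pos i
    have hscale : X.scale i ≤ X.ρ := X.scale_zero ▸ X.scale_anti i.zero_le
    simp only [true_or, filter_true, X.scale_zero]
    rw [← div_le_iff₀ X.card_V_pos, ← nnratCast_dens, ContainerParams.rate]
    set x : ℝ := ((container X.G w).dens : ℝ)
    set r := max 1 ((x - X.ρ) / X.scale i)
    have hr : 1 ≤ r := le_max_left _ _
    have hx : x - X.ρ ≤ r * X.scale i := (div_le_iff₀ hpos).1 (le_max_right _ _)
    have hrρ : X.ρ ≤ r * X.ρ := le_mul_of_one_le_left X.ρ_pos.le hr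
    have hrscale : r * X.scale i ≤ r * X.ρ := by gcongr
    have hA := mul_le_mul_of_nonneg_right X.twenty_le_A (X.ρ_pos.le.trans hrρ)
    linarith [X.ρ_pos]
  · simpa using (h.card_above_lt k (by omega)).le

lemma Terminal.adjPairs_lowPart_le (h : X.Terminal i w v) {A : Finset V}
    (hA : A ⊆ lowPart X.G w (v (i + X.α))) :
    (adjPairs X.G A (container X.G w) : ℝ) ≤
      8 * (i + X.α + 1) * X.rate i (container X.G w).dens ^ 2 * X.μ *
        (Fintype.card V : ℝ) ^ 2 := by
  set R := X.rate i (container X.G w).dens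
  refine (h.adjPairs_le hA (b := fun k => R * X.scale k)
    fun k hk => le_trans ?_ (h.card_above_le hk)).trans_eq ?_
  · gcongr
    exact hA.trans (lowPart_subset _ _)
  · have hratio : ∀ k ∈ range (i + X.α + 1), R * X.scale k / X.scale (k + 1) = 2 * R := by
      intro k _
      have := X.scale_pos k
      rw [X.scale_succ]
      field_simp
    rw [sum_congr rfl hratio, sum_const, card_range, nsmul_eq_mul, Nat.cast_add,
      Nat.cast_add, Nat.cast_one]
    ring

lemma Terminal.le_card_lowPart (h : X.Terminal i w v)
    (hgap : X.scale i < (container X.G w).dens - X.ρ) :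
    (X.ρ + 15 / 16 * ((container X.G w).dens - X.ρ)) * Fintype.card V ≤
      #(lowPart X.G w (v (i + X.α))) := by
  have hpos := X.scale_pos i
  have habove := (h.card_above_lt _ le_rfl).le
  have hcard : (#(lowPart X.G w (v (i + X.α))) : ℝ) + #{u ∈ container X.G w |
      containerDegree X.G w (v (i + X.α)) < containerDegree X.G w u} = #(container X.G w) := by
    exact_mod_cast card_lowPart w (v (i + X.α))
  have hdens : ((container X.G w).dens : ℝ) * Fintype.card V = #(container X.G w) := by
    rw [nnratCast_dens, div_mul_cancel₀ _ X.card_V_pos.ne']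
  rw [X.rate_eq_of_lt hgap] at habove
  set g := ((container X.G w).dens : ℝ) - X.ρ
  have hg : 0 < g := hpos.trans hgap
  have hloss : X.A * (g / X.scale i) * X.scale (i + X.α + 1) ≤ g / 16 := by
    calc X.A * (g / X.scale i) * X.scale (i + X.α + 1)
        = g / X.scale i * (X.A * X.scale (i + X.α + 1)) := by ring
      _ ≤ g / X.scale i * (X.scale i / 16) :=
          mul_le_mul_of_nonneg_left (X.A_mul_scale_le i) (by positivity)
      _ = g / 16 := by field_simp
  linarith [mul_le_mul_of_nonneg_right hloss X.card_V_pos.le]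

/-- A nearly complete sparse set inside the low-degree part of a terminal container, few of whose
vertices have large degree into that container. -/
structure Seed (X : SparseSetting V) (i : ℕ) (w : List (V × Bool)) (v : ℕ → V)
    (B : Finset V) : Prop where
  subset : B ⊆ lowPart X.G w (v (i + X.α))
  card_le : (#B : ℝ) ≤ X.ρ * Fintype.card V
  le_card : (X.ρ - 8 * X.scale i) * Fintype.card V ≤ #B
  sparse : (adjPairs X.G B B : ℝ) ≤ X.ε * (Fintype.card V : ℝ) ^ 2
  card_above_le : ∀ k < i + X.α,
    (#{u ∈ B | containerDegree X.G w (v k) < containerDegree X.G w u} : ℝ) ≤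
      (2 * X.scale i + 2 * X.scale (k + 1)) * Fintype.card V

variable {B : Finset V}

lemma Seed.adjPairs_container_le (hB : X.Seed i w v B) (h : X.Terminal i w v) :
    (adjPairs X.G B (container X.G w) : ℝ) ≤ 528 * X.A * (i + X.α + 1) * X.μ *
      X.rate i (container X.G w).dens * (Fintype.card V : ℝ) ^ 2 := by
  refine (h.adjPairs_le hB.subset (b := fun k => 2 * X.scale i + 4 * X.scale (k + 1)) ?_).trans ?_
  · rintro (_ | k) hk
    · have hscale := X.scale_pos i
      simp only [true_or, filter_true]
      rw [X.scale_succ, X.scale_zero]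
      refine hB.card_le.trans (mul_le_mul_of_nonneg_right ?_ X.card_V_pos.le)
      linarith [X.ρ_pos]
    · have habove := hB.card_above_le k (by omega)
      have hscale : 4 * X.scale (k + 1 + 1) = 2 * X.scale (k + 1) := by
        rw [X.scale_succ (k + 1)]
        ring
      simpa [hscale] using habove
  · have hratio : ∀ k ∈ range (i + X.α + 1), (2 * X.scale i + 4 * X.scale (k + 1)) /
        X.scale (k + 1) = 2 * (X.scale i / X.scale (k + 1)) + 4 := by
      intro k _
      have := X.scale_pos (k + 1)
      field_simp
    rw [sum_congr rfl hratio, sum_add_distrib, ← mul_sum, sum_const, card_range, nsmul_eq_mul,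
      Nat.cast_add, Nat.cast_add, Nat.cast_one]
    have hcoeff : 2 * ∑ k ∈ range (i + X.α + 1), X.scale i / X.scale (k + 1) +
        (i + X.α + 1) * 4 ≤ 132 * X.A * (i + X.α + 1) := by
      have hprod : 0 ≤ (X.A - 1) * (i + X.α) := mul_nonneg (by linarith [X.twenty_le_A])
        (by positivity)
      linarith [X.sum_scale_div_scale_le i, X.twenty_le_A]
    have hR := X.rate_pos i (container X.G w).dens
    have hμ := X.μ_pos
    refine (mul_le_mul_of_nonneg_right hcoeff (by positivity)).trans_eq ?_
    ring

lemma natCeil_rho_mul_lt (X : SparseSetting V) :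
    (⌈X.ρ * Fintype.card V⌉₊ : ℝ) < X.ρ * Fintype.card V + 1 :=
  Nat.ceil_lt_add_one (mul_nonneg X.ρ_pos.le X.card_V_pos.le)

lemma Seed.card_le_natCeil (hB : X.Seed i w v B) : #B ≤ ⌈X.ρ * Fintype.card V⌉₊ := by
  exact_mod_cast hB.card_le.trans (Nat.le_ceil _)

lemma Terminal.natCeil_le_card_lowPart (h : X.Terminal i w v) (hi : i ≤ X.I)
    (hgap : X.scale i < (container X.G w).dens - X.ρ) :
    ⌈X.ρ * Fintype.card V⌉₊ ≤ #(lowPart X.G w (v (i + X.α))) := by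
  have hgapV := mul_le_mul_of_nonneg_right hgap.le X.card_V_pos.le
  refine Nat.ceil_le.2 (le_trans ?_ (h.le_card_lowPart hgap))
  linarith [X.four_le_scale_mul hi]

lemma Seed.fraction_mul_rate_le (hB : X.Seed i w v B) (h : X.Terminal i w v) (hi : i ≤ X.I)
    (hgap : X.scale i < (container X.G w).dens - X.ρ) :
    ((⌈X.ρ * Fintype.card V⌉₊ : ℝ) - #B) / #(lowPart X.G w (v (i + X.α)) \ B) *
      X.rate i (container X.G w).dens ≤ 10 * X.A := by
  have hpos := X.scale_pos i
  have hV := X.card_V_pos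
  have hA := X.A_pos
  have hcard := h.le_card_lowPart hgap
  have hfour := X.four_le_scale_mul hi
  rw [X.rate_eq_of_lt hgap, card_sdiff_of_subset hB.subset,
    Nat.cast_sub (card_le_card hB.subset)]
  set g := ((container X.G w).dens : ℝ) - X.ρ
  set N : ℝ := (Fintype.card V : ℝ)
  have hg : 0 < g := hpos.trans hgap
  have hroom : 15 / 16 * g * N ≤ #(lowPart X.G w (v (i + X.α))) - (#B : ℝ) := by
    linarith [hB.card_le]
  have hneed : (⌈X.ρ * N⌉₊ : ℝ) - #B ≤ 9 * (X.scale i * N) := by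
    linarith [hB.le_card, X.natCeil_rho_mul_lt]
  calc ((⌈X.ρ * N⌉₊ : ℝ) - #B) / (#(lowPart X.G w (v (i + X.α))) - #B) *
        (X.A * (g / X.scale i))
      ≤ 9 * (X.scale i * N) / (15 / 16 * g * N) * (X.A * (g / X.scale i)) := by gcongr
    _ = 48 / 5 * X.A := by field_simp; norm_num
    _ ≤ 10 * X.A := by linarith

lemma Seed.mul_adjPairs_le (hB : X.Seed i w v B) (h : X.Terminal i w v) {U : Finset V}
    (hU : U ⊆ container X.G w) {t : ℝ} (ht : 0 ≤ t)
    (htR : t * X.rate i (container X.G w).dens ≤ 10 * X.A) :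
    t * adjPairs X.G U B ≤
      5280 * (X.A ^ 2 * (i + X.α + 1) * X.μ * (Fintype.card V : ℝ) ^ 2) := by
  have hA := X.A_pos
  have hμ := X.μ_pos
  have hUB : (adjPairs X.G U B : ℝ) ≤ adjPairs X.G B (container X.G w) := by
    rw [adjPairs_comm]
    exact_mod_cast adjPairs_mono subset_rfl hU
  replace hUB := hUB.trans (hB.adjPairs_container_le h)
  set R := X.rate i (container X.G w).dens
  set N : ℝ := (Fintype.card V : ℝ)
  calc t * adjPairs X.G U B ≤ t * (528 * X.A * (i + X.α + 1) * X.μ * R * N ^ 2) := by gcongr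
    _ = t * R * (528 * X.A * (i + X.α + 1) * X.μ * N ^ 2) := by ring
    _ ≤ 10 * X.A * (528 * X.A * (i + X.α + 1) * X.μ * N ^ 2) := by gcongr
    _ = 5280 * (X.A ^ 2 * (i + X.α + 1) * X.μ * N ^ 2) := by ring

lemma Terminal.sq_mul_adjPairs_le (h : X.Terminal i w v) {U : Finset V}
    (hU : U ⊆ lowPart X.G w (v (i + X.α))) {t : ℝ} (ht : 0 ≤ t)
    (htR : t * X.rate i (container X.G w).dens ≤ 10 * X.A) :
    t ^ 2 * adjPairs X.G U U ≤
      800 * (X.A ^ 2 * (i + X.α + 1) * X.μ * (Fintype.card V : ℝ) ^ 2) := by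
  have hμ := X.μ_pos
  have hR := X.rate_pos i (container X.G w).dens
  have hUU : (adjPairs X.G U U : ℝ) ≤ adjPairs X.G U (container X.G w) := by
    exact_mod_cast adjPairs_mono subset_rfl (hU.trans (lowPart_subset _ _))
  replace hUU := hUU.trans (h.adjPairs_lowPart_le hU)
  set R := X.rate i (container X.G w).dens
  set N : ℝ := (Fintype.card V : ℝ)
  calc t ^ 2 * adjPairs X.G U U ≤ t ^ 2 * (8 * (i + X.α + 1) * R ^ 2 * X.μ * N ^ 2) := by gcongr
    _ = (t * R) ^ 2 * (8 * (i + X.α + 1) * X.μ * N ^ 2) := by ring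
    _ ≤ (10 * X.A) ^ 2 * (8 * (i + X.α + 1) * X.μ * N ^ 2) := by gcongr
    _ = 800 * (X.A ^ 2 * (i + X.α + 1) * X.μ * N ^ 2) := by ring

lemma Seed.hasSparseSet (hB : X.Seed i w v B) (h : X.Terminal i w v) (hi : i ≤ X.I)
    (hgap : X.scale i < (container X.G w).dens - X.ρ) : HasSparseSet X.G X.ρ X.ε := by
  obtain ⟨B', hcard, hB'⟩ := exists_superset_adjPairs_le (G := X.G) hB.subset hB.card_le_natCeil
    (h.natCeil_le_card_lowPart hi hgap) rfl
  refine ⟨B', hcard ▸ Nat.le_ceil _, hB'.trans_lt ?_⟩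
  have htR := hB.fraction_mul_rate_le h hi hgap
  set U := lowPart X.G w (v (i + X.α)) \ B
  set t := ((⌈X.ρ * Fintype.card V⌉₊ : ℝ) - #B) / #U
  have ht : 0 ≤ t :=
    div_nonneg (sub_nonneg.2 (by exact_mod_cast hB.card_le_natCeil)) (Nat.cast_nonneg _)
  have hcross := hB.mul_adjPairs_le h (sdiff_subset.trans (lowPart_subset _ _) : U ⊆ _) ht htR
  have hinside := h.sq_mul_adjPairs_le (sdiff_subset : U ⊆ _) ht htR
  linarith [hB.sparse, mul_pos X.ε_pos (pow_pos X.card_V_pos 2),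
    mul_le_mul_of_nonneg_right (X.sq_A_mul_le hi) (sq_nonneg (Fintype.card V : ℝ))]

lemma Seed.empty (X : SparseSetting V) (w : List (V × Bool)) (v : ℕ → V) : X.Seed 3 w v ∅ where
  subset := empty_subset _
  card_le := by simpa using mul_nonneg X.ρ_pos.le X.card_V_pos.le
  le_card := by
    have hscale : X.ρ - 8 * X.scale 3 = 0 := by
      rw [ContainerParams.scale]
      ring
    simp [hscale]
  sparse := by simpa [adjPairs] using mul_nonneg X.ε_pos.le (sq_nonneg (Fintype.card V : ℝ))
  card_above_le k _ := by
    have hi := X.scale_pos 3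
    have hk := X.scale_pos (k + 1)
    simp only [filter_empty, card_empty, Nat.cast_zero]
    positivity

/-- The `i`-th run can be completed to a sparse container that misses only a small part of `J`. -/
def HasSparseContainer (X : SparseSetting V) (i : ℕ) : Prop :=
  ∃ w : List (V × Bool), (∀ a ∈ w, a.1 ∈ X.J) ∧ X.unitCost * w.length ≤ X.scale i / 4 ∧
    (X.ρ - X.scale i / 4) * X.s ≤ #(X.J ∩ container X.G w) ∧
    (adjPairs X.G (container X.G w) (container X.G w) : ℝ) ≤ X.ε * (Fintype.card V : ℝ) ^ 2

lemma Terminal.hasSparseContainer (h : X.Terminal i w v) (hi : i ≤ X.I)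
    (hgap : (container X.G w).dens - X.ρ ≤ X.scale i) : X.HasSparseContainer i := by
  have hpos := X.scale_pos i
  have hlast : 20 * X.scale (i + X.α + 1) ≤ X.scale i / 16 :=
    (mul_le_mul_of_nonneg_right X.twenty_le_A (X.scale_pos _).le).trans (X.A_mul_scale_le i)
  refine ⟨_, h.mem_of_mem_lowPart_word le_rfl, h.unitCost_mul_length_le hi _,
    le_trans (mul_le_mul_of_nonneg_right ?_ X.s_pos.le) (h.le_card_inter_lowPart hi le_rfl), ?_⟩
  · linarith
  · have hpairs := h.adjPairs_lowPart_le subset_rfl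
    rw [X.rate_eq_of_le hgap] at hpairs
    have hmono : (adjPairs X.G (lowPart X.G w (v (i + X.α))) (lowPart X.G w (v (i + X.α))) : ℝ) ≤
        adjPairs X.G (lowPart X.G w (v (i + X.α))) (container X.G w) := by
      exact_mod_cast adjPairs_mono subset_rfl (lowPart_subset _ _)
    refine hmono.trans (hpairs.trans ?_)
    have hcost := mul_le_mul_of_nonneg_right (X.sq_A_mul_le hi) (sq_nonneg (Fintype.card V : ℝ))
    linarith [mul_pos X.ε_pos (pow_pos X.card_V_pos 2)]

lemma Terminal.lt_card_lowPart_inter {w' : List (V × Bool)} (h : X.Terminal (i + 1) w v)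
    (hi : i + 1 ≤ X.I) (hJ : ∀ a ∈ w', a.1 ∈ X.J) (hlen : X.unitCost * w'.length ≤ X.scale i / 4)
    (hcard : (X.ρ - X.scale i / 4) * X.s ≤ #(X.J ∩ container X.G w'))
    (hk : k ≤ i + 1 + X.α) :
    (X.ρ - (2 * X.scale (i + 1) + 2 * X.scale (k + 1))) * Fintype.card V <
      #(lowPart X.G w (v k) ∩ container X.G w') := by
  have hpos := X.scale_pos (i + 1)
  have hposk := X.scale_pos (k + 1)
  have hscale := X.scale_succ i
  have hdens := lt_dens_inter (h.mem_of_mem_lowPart_word hk) hJ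
    (δ := 2 * X.scale (i + 1) + 2 * X.scale (k + 1)) (by linarith [X.scale_anti hi])
    (by linarith [h.unitCost_mul_length_le hi k]) (by linarith) (h.le_card_inter_lowPart hi hk)
    hcard
  rwa [nnratCast_dens, lt_div_iff₀ X.card_V_pos] at hdens

lemma Terminal.exists_seed (h : X.Terminal (i + 1) w v) (hi : i + 1 ≤ X.I)
    (hi' : X.HasSparseContainer i) :
    HasSparseSet X.G X.ρ X.ε ∨ ∃ B, X.Seed (i + 1) w v B := by
  obtain ⟨w', hJ, hlen, hcard, hsparse⟩ := hi'
  have hlt {k : ℕ} (hk : k ≤ i + 1 + X.α) := h.lt_card_lowPart_inter hi hJ hlen hcard hk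
  set B := lowPart X.G w (v (i + 1 + X.α)) ∩ container X.G w'
  have hBB : (adjPairs X.G B B : ℝ) ≤ X.ε * (Fintype.card V : ℝ) ^ 2 := by
    refine le_trans ?_ hsparse
    exact_mod_cast adjPairs_mono inter_subset_right inter_subset_right
  rcases lt_or_ge (X.ρ * Fintype.card V) #B with hB | hB
  · refine Or.inl ⟨B, hB.le, hBB.trans_lt ?_⟩
    linarith [mul_pos X.ε_pos (pow_pos X.card_V_pos 2)]
  refine Or.inr ⟨B, inter_subset_left, hB, le_trans ?_ (hlt le_rfl).le, hBB, fun k hk => ?_⟩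
  · have hscale := X.scale_anti (show i + 1 ≤ i + 1 + X.α + 1 by omega)
    refine mul_le_mul_of_nonneg_right ?_ X.card_V_pos.le
    linarith [X.scale_pos (i + 1)]
  · have hsub : lowPart X.G w (v k) ∩ container X.G w' ⊆
        {u ∈ B | ¬ containerDegree X.G w (v k) < containerDegree X.G w u} := by
      intro u hu
      obtain ⟨hu, hu'⟩ := mem_inter.1 hu
      obtain ⟨huC, hdeg⟩ := mem_lowPart.1 hu
      exact mem_filter.2 ⟨mem_inter.2 ⟨mem_lowPart.2 ⟨huC, hdeg.trans (h.degree_le k hk.le)⟩, hu'⟩,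
        hdeg.not_gt⟩
    have hsplit : (#{u ∈ B | containerDegree X.G w (v k) < containerDegree X.G w u} : ℝ) +
        #{u ∈ B | ¬ containerDegree X.G w (v k) < containerDegree X.G w u} = #B := by
      exact_mod_cast card_filter_add_card_filter_not _
    have hle : (#(lowPart X.G w (v k) ∩ container X.G w') : ℝ) ≤
        #{u ∈ B | ¬ containerDegree X.G w (v k) < containerDegree X.G w u} := by
      exact_mod_cast card_le_card hsub
    linarith [hlt hk.le]

lemma hasSparseSet_or_hasSparseContainer (X : SparseSetting V) {i : ℕ} (hi₃ : 3 ≤ i)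
    (hi : i ≤ X.I) : HasSparseSet X.G X.ρ X.ε ∨ X.HasSparseContainer i := by
  induction i, hi₃ using Nat.le_induction with
  | base =>
    obtain ⟨w, v, h⟩ := X.exists_terminal (by omega) hi
    rcases le_or_gt ((container X.G w).dens - X.ρ) (X.scale 3) with hgap | hgap
    exacts [.inr (h.hasSparseContainer hi hgap), .inl ((Seed.empty X w v).hasSparseSet h hi hgap)]
  | succ i hi₃ ih =>
    rcases ih (by omega) with hset | hcontainer
    · exact .inl hset
    obtain ⟨w, v, h⟩ := X.exists_terminal (by omega) hi
    rcases le_or_gt ((container X.G w).dens - X.ρ) (X.scale (i + 1)) with hgap | hgap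
    · exact .inr (h.hasSparseContainer hi hgap)
    rcases h.exists_seed hi hcontainer with hset | ⟨B, hB⟩
    exacts [.inl hset, .inl (hB.hasSparseSet h hi hgap)]

lemma scale_I_mul_rho_le (X : SparseSetting V) : X.scale X.I * X.ρ ≤ X.ε / 8 := by
  rw [ContainerParams.scale, div_mul_eq_mul_div, div_le_iff₀ (by positivity)]
  linarith [X.le_two_pow_I]

lemma card_sdiff_mul_card_le (X : SparseSetting V) {C B : Finset V} (hCB : C ⊆ B)
    (hB : #B = ⌈X.ρ * Fintype.card V⌉₊)
    (hC : (X.ρ - X.scale X.I) * Fintype.card V < #C) :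
    (#(B \ C) : ℝ) * #B ≤ 3 * (X.scale X.I * X.ρ) * (Fintype.card V : ℝ) ^ 2 := by
  have hceil := X.natCeil_rho_mul_lt
  have hfour := X.four_le_scale_mul le_rfl
  have hscale : X.scale X.I ≤ X.ρ / 8 := by
    refine (X.scale_anti X.three_le_I).trans_eq ?_
    norm_num [ContainerParams.scale]
  have hnew : (#(B \ C) : ℝ) ≤ 2 * X.scale X.I * Fintype.card V := by
    rw [card_sdiff_of_subset hCB, Nat.cast_sub (card_le_card hCB), hB]
    linarith
  have hcard : (#B : ℝ) ≤ 3 / 2 * X.ρ * Fintype.card V := by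
    rw [hB]
    linarith [mul_le_mul_of_nonneg_right hscale X.card_V_pos.le, mul_pos X.ρ_pos X.card_V_pos]
  refine (mul_le_mul hnew hcard (Nat.cast_nonneg _) ((Nat.cast_nonneg _).trans hnew)).trans_eq ?_
  ring

lemma hasSparseSet_of_container {w : List (V × Bool)}
    (hsparse : (adjPairs X.G (container X.G w) (container X.G w) : ℝ) ≤
      X.ε * (Fintype.card V : ℝ) ^ 2)
    (hdens : X.ρ - X.scale X.I < (container X.G w).dens) : HasSparseSet X.G X.ρ X.ε := by
  have hε := mul_pos X.ε_pos (pow_pos X.card_V_pos 2)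
  rw [nnratCast_dens, lt_div_iff₀ X.card_V_pos] at hdens
  rcases le_or_gt (X.ρ * Fintype.card V) #(container X.G w) with hcard | hcard
  · exact ⟨_, hcard, hsparse.trans_lt (by linarith)⟩
  obtain ⟨B, hCB, -, hB⟩ := exists_subsuperset_card_eq (subset_univ (container X.G w))
    (n := ⌈X.ρ * Fintype.card V⌉₊) (by exact_mod_cast hcard.le.trans (Nat.le_ceil _))
    (by rw [card_univ]; exact Nat.ceil_le.2 (mul_le_of_le_one_left X.card_V_pos.le X.ρ_le_one))
  refine ⟨B, hB ▸ Nat.le_ceil _, ?_⟩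
  have hadd : (adjPairs X.G B B : ℝ) ≤ adjPairs X.G (container X.G w) (container X.G w) +
      2 * (#(B \ container X.G w) * #B) := by
    exact_mod_cast adjPairs_le_add_of_subset hCB
  linarith [X.card_sdiff_mul_card_le hCB hB hdens,
    mul_le_mul_of_nonneg_right X.scale_I_mul_rho_le (sq_nonneg (Fintype.card V : ℝ))]

lemma hasSparseSet (X : SparseSetting V) : HasSparseSet X.G X.ρ X.ε := by
  rcases X.hasSparseSet_or_hasSparseContainer X.three_le_I le_rfl with
    hset | ⟨w, hJ, hlen, hcard, hsparse⟩
  · exact hset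
  have hpos := X.scale_pos X.I
  refine hasSparseSet_of_container hsparse (lt_dens_container hJ le_rfl (by linarith)
    (le_trans (mul_le_mul_of_nonneg_right ?_ X.s_pos.le) hcard))
  linarith

end SparseSetting

section SampleIntersection

variable {V : Type*} [DecidableEq V]

lemma sum_powerset_ite_subset_pow (S D : Finset V) (θ : ℝ) :
    (∑ B ∈ D.powerset, if B ⊆ S then θ ^ #B else 0) = (1 + θ) ^ #(S ∩ D) := by
  rw [← sum_filter, add_comm 1 θ, ← sum_pow_mul_eq_add_pow]
  simp only [one_pow, mul_one]
  refine sum_congr ?_ fun _ _ => rfl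
  ext B
  simp only [mem_filter, mem_powerset, subset_inter_iff]
  tauto

lemma one_add_pow_card_inter_le (S F C : Finset V) {θ : ℝ} (hθ : 0 ≤ θ) :
    (1 + θ) ^ #(S ∩ C) ≤
      (1 + θ) ^ #F * ∑ B ∈ (C \ F).powerset, if B ⊆ S then θ ^ #B else 0 := by
  rw [sum_powerset_ite_subset_pow, ← pow_add]
  refine pow_le_pow_right₀ (by linarith) ?_
  refine (card_le_card (t := F ∪ S ∩ (C \ F)) fun v hv => ?_).trans (card_union_le _ _)
  simp only [mem_inter, mem_union, mem_sdiff] at *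
  tauto

variable [Fintype V]

lemma sum_filter_subset_pow_card_inter_le {s : ℕ} (hs : s ≤ Fintype.card V) (F C : Finset V)
    {θ : ℝ} (hθ : 0 ≤ θ) :
    ∑ S ∈ (univ : Finset V).powersetCard s with F ⊆ S, (1 + θ) ^ #(S ∩ C) ≤
      ((s : ℝ) / Fintype.card V) ^ #F * (1 + θ) ^ #F * Real.exp (θ * (s * C.dens)) *
        (Fintype.card V).choose s := by
  set p : ℝ := (s : ℝ) / Fintype.card V with hp
  have hp0 : 0 ≤ p := by positivity
  have hexp : (θ * p + 1) ^ #(C \ F) ≤ Real.exp (θ * (s * C.dens)) :=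
    calc (θ * p + 1) ^ #(C \ F) ≤ (θ * p + 1) ^ #C :=
          pow_le_pow_right₀ (by nlinarith [mul_nonneg hθ hp0]) (card_le_card sdiff_subset)
      _ ≤ Real.exp (θ * p) ^ #C := by gcongr; exact Real.add_one_le_exp _
      _ = Real.exp (θ * (s * C.dens)) := by
          rw [← Real.exp_nat_mul, nnratCast_dens, hp]; congr 1; ring
  calc ∑ S ∈ (univ : Finset V).powersetCard s with F ⊆ S, (1 + θ) ^ #(S ∩ C)
      ≤ ∑ S ∈ (univ : Finset V).powersetCard s with F ⊆ S,
          (1 + θ) ^ #F * ∑ B ∈ (C \ F).powerset, (if B ⊆ S then θ ^ #B else 0) :=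
        sum_le_sum fun S _ => one_add_pow_card_inter_le S F C hθ
    _ = (1 + θ) ^ #F * ∑ B ∈ (C \ F).powerset,
          θ ^ #B * #{S ∈ (univ : Finset V).powersetCard s | F ∪ B ⊆ S} := by
        rw [← mul_sum, sum_comm]
        congr 1
        refine sum_congr rfl fun B _ => ?_
        rw [← sum_filter, sum_const, nsmul_eq_mul, mul_comm, filter_filter]
        simp only [union_subset_iff]
    _ ≤ (1 + θ) ^ #F * ∑ B ∈ (C \ F).powerset,
          θ ^ #B * (p ^ (#F + #B) * (Fintype.card V).choose s) := by
        gcongr with B hB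
        have hdisj : Disjoint F B := disjoint_sdiff.mono_right (mem_powerset.1 hB)
        have := card_filter_subset_le (B := univ) (T := F ∪ B) (w := s) (by rwa [card_univ])
        rwa [card_union_of_disjoint hdisj, card_univ] at this
    _ = p ^ #F * (1 + θ) ^ #F * (∑ B ∈ (C \ F).powerset, (θ * p) ^ #B * 1 ^ (#(C \ F) - #B)) *
          (Fintype.card V).choose s := by
        rw [mul_sum, mul_sum, sum_mul]
        refine sum_congr rfl fun B _ => ?_
        rw [pow_add, mul_pow, one_pow]
        ring
    _ ≤ _ := by
        rw [sum_pow_mul_eq_add_pow]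
        gcongr

lemma chernoff_exponent_le {ρ δ d : ℝ} (hρ : 0 < ρ) (hδ : 0 ≤ δ) (hδρ : δ ≤ ρ) (hd : d ≤ ρ - δ) :
    δ / (2 * ρ) * d - Real.log (1 + δ / (2 * ρ)) * (ρ - δ / 2) ≤ -(δ ^ 2 / (8 * ρ)) := by
  obtain ⟨θ, hθ⟩ : ∃ θ, θ = δ / (2 * ρ) := ⟨_, rfl⟩
  have hθ0 : 0 ≤ θ := hθ ▸ by positivity
  have hδθ : δ = 2 * ρ * θ := by rw [hθ]; field_simp
  have hlog : θ - θ ^ 2 / 2 ≤ Real.log (1 + θ) := by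
    refine le_trans ?_ (Real.le_log_one_add_of_nonneg hθ0)
    rw [le_div_iff₀ (by linarith)]
    nlinarith [pow_nonneg hθ0 3]
  have hsq : δ ^ 2 / (8 * ρ) = ρ * θ ^ 2 / 2 := by rw [hδθ]; field_simp; ring
  have hlin : θ * d ≤ θ * (ρ - δ) := by gcongr
  have hlogmul : (θ - θ ^ 2 / 2) * (ρ - δ / 2) ≤ Real.log (1 + θ) * (ρ - δ / 2) := by
    gcongr; linarith
  rw [← hθ, hsq]
  have : 0 ≤ ρ * θ ^ 3 := by positivity
  rw [hδθ] at hlin hlogmul ⊢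
  nlinarith

lemma card_filter_subset_inter_le {s : ℕ} (hs : s ≤ Fintype.card V) (F C : Finset V) {ρ δ : ℝ}
    (hρ : 0 < ρ) (hδ : 0 ≤ δ) (hC : C.dens ≤ ρ - δ) :
    (#{S ∈ (univ : Finset V).powersetCard s | F ⊆ S ∧ (ρ - δ / 2) * s ≤ #(S ∩ C)} : ℝ) ≤
      ((s : ℝ) / Fintype.card V) ^ #F * 2 ^ #F * Real.exp (-(δ ^ 2 * s / (8 * ρ))) *
        (Fintype.card V).choose s := by
  set 𝒮 := {S ∈ (univ : Finset V).powersetCard s | F ⊆ S ∧ (ρ - δ / 2) * s ≤ #(S ∩ C)}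
  have hδρ : δ ≤ ρ := by
    have : (0 : ℝ) ≤ C.dens := by positivity
    linarith
  set θ := δ / (2 * ρ)
  have hθ0 : 0 ≤ θ := by positivity
  have hθ1 : θ ≤ 1 := (div_le_one (by positivity)).2 (by linarith)
  have hmarkov : (#𝒮 : ℝ) * (1 + θ) ^ ((ρ - δ / 2) * s) ≤
      ∑ S ∈ (univ : Finset V).powersetCard s with F ⊆ S, (1 + θ) ^ #(S ∩ C) := by
    rw [← nsmul_eq_mul, ← sum_const]
    refine le_trans (sum_le_sum fun S hS => ?_) (sum_le_sum_of_subset_of_nonneg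
      (monotone_filter_right _ fun _ _ => And.left) fun _ _ _ => by positivity)
    rw [← Real.rpow_natCast]
    exact Real.rpow_le_rpow_of_exponent_le (by linarith) (mem_filter.1 hS).2.2
  have hexp : Real.exp (θ * (s * C.dens)) / (1 + θ) ^ ((ρ - δ / 2) * s) ≤
      Real.exp (-(δ ^ 2 * s / (8 * ρ))) := by
    rw [Real.rpow_def_of_pos (by linarith), ← Real.exp_sub, Real.exp_le_exp]
    calc θ * (s * C.dens) - Real.log (1 + θ) * ((ρ - δ / 2) * s)
        = (θ * C.dens - Real.log (1 + θ) * (ρ - δ / 2)) * s := by ring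
      _ ≤ -(δ ^ 2 / (8 * ρ)) * s := by gcongr; exact chernoff_exponent_le hρ hδ hδρ hC
      _ = -(δ ^ 2 * s / (8 * ρ)) := by ring
  calc (#𝒮 : ℝ) ≤ ((s : ℝ) / Fintype.card V) ^ #F * (1 + θ) ^ #F * Real.exp (θ * (s * C.dens)) *
          (Fintype.card V).choose s / (1 + θ) ^ ((ρ - δ / 2) * s) := by
        rw [le_div_iff₀ (by positivity)]
        exact hmarkov.trans (sum_filter_subset_pow_card_inter_le hs F C hθ0)
    _ = ((s : ℝ) / Fintype.card V) ^ #F * (1 + θ) ^ #F *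
          (Real.exp (θ * (s * C.dens)) / (1 + θ) ^ ((ρ - δ / 2) * s)) *
          (Fintype.card V).choose s := by ring
    _ ≤ _ := by
        gcongr
        linarith

end SampleIntersection

section Letters

variable {V : Type*} [DecidableEq V]

/-- The vertices occurring in a word. -/
def letters {τ : ℕ} (f : Fin τ → V × Bool) : Finset V := univ.image fun i => (f i).1

lemma card_letters_le {τ : ℕ} (f : Fin τ → V × Bool) : #(letters f) ≤ τ :=
  card_image_le.trans (by simp)

lemma letters_cons {τ : ℕ} (a : V × Bool) (f : Fin τ → V × Bool) :
    letters (Fin.cons a f : Fin (τ + 1) → V × Bool) = insert a.1 (letters f) := by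
  ext v
  simp [letters, Fin.exists_fin_succ, eq_comm]

lemma pow_card_letters_cons_le {p : ℝ} (hp : 0 ≤ p) {τ : ℕ} (a : V × Bool)
    (f : Fin τ → V × Bool) :
    p ^ #(letters (Fin.cons a f : Fin (τ + 1) → V × Bool)) ≤
      p ^ #(letters f) * (p + if a.1 ∈ letters f then 1 else 0) := by
  rw [letters_cons]
  split_ifs with ha
  · rw [insert_eq_of_mem ha]
    exact le_mul_of_one_le_right (by positivity) (by linarith)
  · rw [card_insert_of_notMem ha, pow_succ, add_zero]

variable [Fintype V]

lemma sum_pow_card_letters_cons_le {p : ℝ} (hp : 0 ≤ p) {τ : ℕ} (f : Fin τ → V × Bool) :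
    ∑ a, p ^ #(letters (Fin.cons a f : Fin (τ + 1) → V × Bool)) ≤
      p ^ #(letters f) * (2 * (p * Fintype.card V + τ)) := by
  refine (sum_le_sum fun a _ => pow_card_letters_cons_le hp a f).trans ?_
  rw [← mul_sum]
  gcongr
  have hmem : ∑ v : V, ∑ _b : Bool, (if v ∈ letters f then (1 : ℝ) else 0) =
      2 * #(letters f) := by
    rw [sum_comm]
    simp
  have hcard : (#(letters f) : ℝ) ≤ τ := by exact_mod_cast card_letters_le f
  rw [sum_add_distrib, sum_const, card_univ, nsmul_eq_mul, Fintype.sum_prod_type, hmem,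
    Fintype.card_prod, Fintype.card_bool]
  push_cast
  linarith

lemma sum_pow_card_letters_le (T : ℕ) {p : ℝ} (hp : 0 ≤ p) {τ : ℕ} (hτ : τ ≤ T) :
    ∑ f : Fin τ → V × Bool, p ^ #(letters f) ≤ (2 * (p * Fintype.card V + T)) ^ τ := by
  induction τ with
  | zero => simp [letters]
  | succ τ ih =>
    have hτT : (τ : ℝ) ≤ T := by exact_mod_cast (Nat.le_succ τ).trans hτ
    calc ∑ f : Fin (τ + 1) → V × Bool, p ^ #(letters f)
        = ∑ f : Fin τ → V × Bool, ∑ a,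
            p ^ #(letters (Fin.cons a f : Fin (τ + 1) → V × Bool)) := by
          rw [← (Fin.consEquiv fun _ : Fin (τ + 1) => V × Bool).sum_comp, Fintype.sum_prod_type,
            sum_comm]
          rfl
      _ ≤ ∑ f : Fin τ → V × Bool, p ^ #(letters f) * (2 * (p * Fintype.card V + T)) := by
          refine sum_le_sum fun f _ => (sum_pow_card_letters_cons_le hp f).trans ?_
          gcongr
      _ ≤ _ := by
          rw [← sum_mul, pow_succ]
          gcongr
          exact ih ((Nat.le_succ τ).trans hτ)

end Letters

section CapturedSamples

variable {V : Type*} [Fintype V] [DecidableEq V] {G : SimpleGraph V} {ρ κ c s : ℝ}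

open Classical in
/-- The intersection of the containers of the two words into which `f` splits after `i` letters. -/
noncomputable def splitContainer (G : SimpleGraph V) {τ : ℕ} (f : Fin τ → V × Bool) (i : ℕ) :
    Finset V :=
  container G ((List.ofFn f).take i) ∩ container G ((List.ofFn f).drop i)

/-- The set `T` is captured, in the sense of `IsCaptured`, by the two words into which `f` splits
after `i` letters. -/
def IsCapturedBy (G : SimpleGraph V) (ρ κ c s : ℝ) {τ : ℕ} (f : Fin τ → V × Bool) (i : ℕ)
    (T : Finset V) : Prop :=
  letters f ⊆ T ∧ ∃ δ, κ ≤ δ ∧ c * τ ≤ δ ∧ (splitContainer G f i).dens ≤ ρ - δ ∧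
    (ρ - δ / 2) * s ≤ #(T ∩ splitContainer G f i)

lemma IsCaptured.exists_isCapturedBy {T : Finset V} (h : IsCaptured G ρ κ c s T) (hc : 0 < c)
    (hρ : ρ ≤ c * s) :
    ∃ τ : ℕ, τ ≤ s ∧ ∃ f : Fin τ → V × Bool, ∃ i ≤ τ, IsCapturedBy G ρ κ c s f i T := by
  obtain ⟨w₁, w₂, h₁, h₂, δ, hκ, hcδ, hdens, hcard⟩ := h
  obtain ⟨w, hw⟩ : ∃ w, w = w₁ ++ w₂ := ⟨_, rfl⟩
  have hlen : w.length = w₁.length + w₂.length := by rw [hw, List.length_append]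
  have hsplit : splitContainer G w.get w₁.length = container G w₁ ∩ container G w₂ := by
    rw [splitContainer, List.ofFn_get, hw, List.take_left, List.drop_left]
  have hcw : c * w.length ≤ δ := by rwa [hlen, Nat.cast_add]
  refine ⟨w.length, ?_, w.get, w₁.length, by omega, ?_, δ, hκ, hcw, ?_, ?_⟩
  · have : (0 : ℝ) ≤ (container G w₁ ∩ container G w₂).dens := by positivity
    exact le_of_mul_le_mul_left (by linarith) hc
  · intro v hv
    obtain ⟨j, -, rfl⟩ := mem_image.1 hv
    have hj : w.get j ∈ w₁ ++ w₂ := hw ▸ List.get_mem _ _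
    exact (List.mem_append.1 hj).elim (h₁ _) (h₂ _)
  · rwa [hsplit]
  · rwa [hsplit]

end CapturedSamples

section UnionBound

variable {V : Type*} [Fintype V] [DecidableEq V] {G : SimpleGraph V} {ρ κ c : ℝ} {s : ℕ}

lemma exp_neg_sq_gap_le {δ : ℝ} (hs : 0 < s) (hρ : 0 < ρ) (hκ : 0 < κ)
    (hκs : 64 * ρ ≤ κ ^ 2 * s) (hlog : Real.log (32 * s) ≤ κ * c * s / (16 * ρ)) {τ : ℕ}
    (hκδ : κ ≤ δ) (hcδ : c * τ ≤ δ) :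
    Real.exp (-(δ ^ 2 * s / (8 * ρ))) ≤ Real.exp (-4) * (1 / (32 * s)) ^ τ := by
  have hpow : (1 / (32 * s) : ℝ) ^ τ = Real.exp (-(τ * Real.log (32 * s))) := by
    rw [Real.exp_neg, Real.exp_nat_mul, Real.exp_log (by positivity), one_div, inv_pow]
  have hδ : 0 ≤ δ := hκ.le.trans hκδ
  have hgap : κ ^ 2 + κ * c * τ ≤ 2 * δ ^ 2 := by
    have hκκ : κ * κ ≤ δ * δ := by gcongr
    have hκc : κ * (c * τ) ≤ δ * δ :=
      mul_le_mul_of_nonneg hκδ hcδ hκ.le hδ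
    linarith
  have hdiv : (κ ^ 2 + κ * c * τ) * s / (16 * ρ) ≤ δ ^ 2 * s / (8 * ρ) := by
    rw [div_le_div_iff₀ (by positivity) (by positivity)]
    have := mul_le_mul_of_nonneg_right hgap (show 0 ≤ s * (8 * ρ) by positivity)
    linarith
  have hfour : 4 ≤ κ ^ 2 * s / (16 * ρ) := by
    rw [le_div_iff₀ (by positivity)]
    linarith
  have hτ : τ * Real.log (32 * s) ≤ τ * (κ * c * s / (16 * ρ)) := by gcongr
  have hsplit : (κ ^ 2 + κ * c * τ) * s / (16 * ρ) =
      κ ^ 2 * s / (16 * ρ) + τ * (κ * c * s / (16 * ρ)) := by field_simp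
  rw [hpow, ← Real.exp_add, Real.exp_le_exp]
  linarith

open Classical in
lemma card_filter_isCapturedBy_le (hsV : s ≤ Fintype.card V) (hs : 0 < s) (hρ : 0 < ρ)
    (hκ : 0 < κ) (hκs : 64 * ρ ≤ κ ^ 2 * s)
    (hlog : Real.log (32 * s) ≤ κ * c * s / (16 * ρ)) {τ : ℕ} (f : Fin τ → V × Bool) (i : ℕ) :
    (#{S ∈ (univ : Finset V).powersetCard s | IsCapturedBy G ρ κ c s f i S} : ℝ) ≤
      ((s : ℝ) / Fintype.card V) ^ #(letters f) *
        (2 ^ τ * (Real.exp (-4) * (1 / (32 * s)) ^ τ) * (Fintype.card V).choose s) := by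
  obtain ⟨δ, hδ⟩ : ∃ δ : ℝ, δ = ρ - (splitContainer G f i).dens := ⟨_, rfl⟩
  by_cases h : κ ≤ δ ∧ c * τ ≤ δ
  · have hsub : {S ∈ (univ : Finset V).powersetCard s | IsCapturedBy G ρ κ c s f i S} ⊆
        {S ∈ (univ : Finset V).powersetCard s | letters f ⊆ S ∧
          (ρ - δ / 2) * s ≤ #(S ∩ splitContainer G f i)} := by
      refine monotone_filter_right _ fun S _ hS => ⟨hS.1, ?_⟩
      obtain ⟨δ', -, -, hdens, hcard⟩ := hS.2
      refine le_trans ?_ hcard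
      gcongr
      linarith
    calc _ ≤ ((s : ℝ) / Fintype.card V) ^ #(letters f) * 2 ^ #(letters f) *
          Real.exp (-(δ ^ 2 * s / (8 * ρ))) * (Fintype.card V).choose s :=
          (Nat.cast_le.2 (card_le_card hsub)).trans
            (card_filter_subset_inter_le hsV _ _ hρ (hκ.le.trans h.1) (by linarith))
      _ ≤ ((s : ℝ) / Fintype.card V) ^ #(letters f) * 2 ^ τ *
          (Real.exp (-4) * (1 / (32 * s)) ^ τ) * (Fintype.card V).choose s := by
          gcongr
          exacts [one_le_two, card_letters_le f, exp_neg_sq_gap_le hs hρ hκ hκs hlog h.1 h.2]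
      _ = _ := by ring
  · rw [filter_eq_empty_iff.2, card_empty, Nat.cast_zero]
    · positivity
    · rintro S - ⟨-, δ', hκδ, hcδ, hdens, -⟩
      exact h ⟨by linarith, by linarith⟩

lemma exp_neg_four_le : Real.exp (-4) ≤ 1 / 32 := by
  rw [Real.exp_neg, ← one_div]
  refine one_div_le_one_div_of_le (by norm_num) ?_
  calc (32 : ℝ) ≤ 2.7 ^ 4 := by norm_num
    _ ≤ Real.exp 1 ^ 4 := by gcongr; linarith [Real.exp_one_gt_d9]
    _ = Real.exp 4 := by rw [← Real.exp_nat_mul]; norm_num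

open Classical in
lemma sum_card_filter_isCapturedBy_le (hsV : s ≤ Fintype.card V) (hs : 0 < s) (hρ : 0 < ρ)
    (hκ : 0 < κ) (hκs : 64 * ρ ≤ κ ^ 2 * s)
    (hlog : Real.log (32 * s) ≤ κ * c * s / (16 * ρ)) {τ : ℕ} (hτ : τ ≤ s) :
    ∑ f : Fin τ → V × Bool, ∑ i ∈ range (τ + 1),
        (#{S ∈ (univ : Finset V).powersetCard s | IsCapturedBy G ρ κ c s f i S} : ℝ) ≤
      (1 / 2) ^ τ * (1 / 32 * (Fintype.card V).choose s) := by
  have hV : (Fintype.card V : ℝ) ≠ 0 := by exact_mod_cast (hs.trans_le hsV).ne'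
  have hletters := sum_pow_card_letters_le (V := V) s
    (show (0 : ℝ) ≤ s / Fintype.card V by positivity) hτ
  rw [div_mul_cancel₀ _ hV] at hletters
  have hcuts : ((τ + 1 : ℕ) : ℝ) ≤ 2 ^ τ := by exact_mod_cast Nat.lt_two_pow_self (n := τ)
  have hexp := exp_neg_four_le
  calc _ ≤ ∑ f : Fin τ → V × Bool, ∑ _i ∈ range (τ + 1),
        ((s : ℝ) / Fintype.card V) ^ #(letters f) *
          (2 ^ τ * (Real.exp (-4) * (1 / (32 * s)) ^ τ) * (Fintype.card V).choose s) :=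
        sum_le_sum fun f _ => sum_le_sum fun i _ =>
          card_filter_isCapturedBy_le hsV hs hρ hκ hκs hlog f i
    _ = ((τ + 1 : ℕ) : ℝ) * ((∑ f : Fin τ → V × Bool,
          ((s : ℝ) / Fintype.card V) ^ #(letters f)) *
          (2 ^ τ * (Real.exp (-4) * (1 / (32 * s)) ^ τ) *
          (Fintype.card V).choose s)) := by
        simp only [sum_const, card_range, nsmul_eq_mul]
        rw [← mul_sum, ← sum_mul]
    _ ≤ 2 ^ τ * ((2 * ((s : ℝ) + s)) ^ τ * (2 ^ τ * (1 / 32 * (1 / (32 * s)) ^ τ) *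
          (Fintype.card V).choose s)) := by
        gcongr
    _ = (2 * (2 * ((s : ℝ) + s)) * 2 * (1 / (32 * s))) ^ τ *
          (1 / 32 * (Fintype.card V).choose s) := by
        simp only [mul_pow]
        ring
    _ = _ := by
        congr 2
        field_simp
        ring

open Classical in
lemma card_filter_isCaptured_le (hsV : s ≤ Fintype.card V) (hs : 0 < s) (hρ : 0 < ρ)
    (hκ : 0 < κ) (hc : 0 < c) (hρs : ρ ≤ c * s) (hκs : 64 * ρ ≤ κ ^ 2 * s)
    (hlog : Real.log (32 * s) ≤ κ * c * s / (16 * ρ)) :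
    (#{S ∈ (univ : Finset V).powersetCard s | IsCaptured G ρ κ c s S} : ℝ) ≤
      1 / 16 * (Fintype.card V).choose s := by
  have hcover : {S ∈ (univ : Finset V).powersetCard s | IsCaptured G ρ κ c s S} ⊆
      (range (s + 1)).biUnion fun τ => univ.biUnion fun f : Fin τ → V × Bool =>
        (range (τ + 1)).biUnion fun i =>
          {S ∈ (univ : Finset V).powersetCard s | IsCapturedBy G ρ κ c s f i S} := by
    intro S hS
    rw [mem_filter] at hS
    obtain ⟨τ, hτ, f, i, hi, hf⟩ := hS.2.exists_isCapturedBy hc hρs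
    simp only [mem_biUnion, mem_range, mem_univ, true_and, mem_filter]
    exact ⟨τ, Nat.lt_succ_of_le (by exact_mod_cast hτ), f, i, Nat.lt_succ_of_le hi, hS.1, hf⟩
  have hunion : (#{S ∈ (univ : Finset V).powersetCard s | IsCaptured G ρ κ c s S} : ℝ) ≤
      ∑ τ ∈ range (s + 1), ∑ f : Fin τ → V × Bool, ∑ i ∈ range (τ + 1),
        (#{S ∈ (univ : Finset V).powersetCard s | IsCapturedBy G ρ κ c s f i S} : ℝ) := by
    exact_mod_cast (card_le_card hcover).trans <| card_biUnion_le.trans <|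
      sum_le_sum fun τ _ => card_biUnion_le.trans <| sum_le_sum fun f _ => card_biUnion_le
  calc _ ≤ ∑ τ ∈ range (s + 1), (1 / 2 : ℝ) ^ τ * (1 / 32 * (Fintype.card V).choose s) :=
        hunion.trans <| sum_le_sum fun τ hτ => sum_card_filter_isCapturedBy_le hsV hs hρ hκ hκs
          hlog (Nat.le_of_lt_succ (mem_range.1 hτ))
    _ ≤ 2 * (1 / 32 * (Fintype.card V).choose s) := by
        rw [← sum_mul]
        gcongr
        exact sum_geometric_two_le _
    _ = _ := by ring

end UnionBound

section LogConcave

/-- Log-concavity of a sequence, in the form that also excludes internal zeros: the ratios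
`p (i + 1) / p i` decrease. -/
def IsLogConcave (p : ℕ → ℝ) : Prop :=
  ∀ ⦃i j : ℕ⦄, j ≤ i → p (i + 1) * p j ≤ p i * p (j + 1)

namespace IsLogConcave

variable {p T : ℕ → ℝ}

lemma tail (hp : IsLogConcave p) (hp0 : ∀ j, 0 ≤ p j) (n : ℕ) :
    IsLogConcave fun l => ∑ j ∈ Ico l n, p j := by
  intro i j hij
  obtain hi | hi := le_or_gt n i
  · simp [Ico_eq_empty_of_le hi, Ico_eq_empty_of_le (hi.trans i.le_succ)]
  have hshift : ∀ j ≤ i, (∑ l ∈ Ico (i + 1) n, p l) * p j ≤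
      (∑ l ∈ Ico i n, p l) * p (j + 1) := fun j hij =>
    calc (∑ l ∈ Ico (i + 1) n, p l) * p j ≤ (∑ l ∈ Ico i n, p (l + 1)) * p j := by
          rw [sum_Ico_add']
          exact mul_le_mul_of_nonneg_right (sum_le_sum_of_subset_of_nonneg
            (Ico_subset_Ico_right n.le_succ) fun _ _ _ => hp0 _) (hp0 j)
      _ ≤ (∑ l ∈ Ico i n, p l) * p (j + 1) := by
          rw [sum_mul, sum_mul]
          exact sum_le_sum fun l hl => hp (hij.trans (mem_Ico.1 hl).1)
  induction hij using Nat.decreasingInduction with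
  | self => exact (mul_comm _ _).le
  | of_succ j hj ih =>
    calc (∑ l ∈ Ico (i + 1) n, p l) * ∑ l ∈ Ico j n, p l
        = (∑ l ∈ Ico (i + 1) n, p l) * p j +
            (∑ l ∈ Ico (i + 1) n, p l) * ∑ l ∈ Ico (j + 1) n, p l := by
          rw [sum_eq_sum_Ico_succ_bot (hj.trans hi), mul_add]
      _ ≤ (∑ l ∈ Ico i n, p l) * p (j + 1) +
            (∑ l ∈ Ico i n, p l) * ∑ l ∈ Ico (j + 1 + 1) n, p l :=
          add_le_add (hshift j hj.le) ih
      _ = (∑ l ∈ Ico i n, p l) * ∑ l ∈ Ico (j + 1) n, p l := by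
          rw [sum_eq_sum_Ico_succ_bot (show j + 1 < n by omega), mul_add]

lemma mul_pow_le (hT : IsLogConcave T) {a : ℕ} {r : ℝ} (ha : 0 < T a) (hr : 0 < r)
    (hra : T (a + 1) = r * T a) (j : ℕ) : T j * r ^ a ≤ T a * r ^ j := by
  obtain hj | hj := le_total a j
  · induction j, hj using Nat.le_induction with
    | base => rfl
    | succ j hj ih =>
      have hstep : T (j + 1) ≤ r * T j := by
        have := hT hj
        rw [hra] at this
        exact le_of_mul_le_mul_right (by linarith) ha
      calc T (j + 1) * r ^ a ≤ r * T j * r ^ a := by gcongr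
        _ = r * (T j * r ^ a) := by ring
        _ ≤ r * (T a * r ^ j) := by gcongr
        _ = T a * r ^ (j + 1) := by ring
  · induction hj using Nat.decreasingInduction with
    | self => rfl
    | of_succ j hj ih =>
      have hstep : r * T j ≤ T (j + 1) := by
        have := hT hj.le
        rw [hra] at this
        exact le_of_mul_le_mul_left (by linarith) ha
      refine le_of_mul_le_mul_left ?_ hr
      calc r * (T j * r ^ a) = r * T j * r ^ a := by ring
        _ ≤ T (j + 1) * r ^ a := by gcongr
        _ ≤ T a * r ^ (j + 1) := ih
        _ = r * (T a * r ^ j) := by ring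

end IsLogConcave

lemma pos_of_le_sum_tail {T : ℕ → ℝ} {m k : ℕ} (h0 : T 0 = 1) (hanti : Antitone T)
    (hmean : (k : ℝ) ≤ ∑ j ∈ range m, T (j + 1)) : 0 < T k := by
  by_contra! hk
  obtain ⟨a, rfl⟩ : ∃ a, k = a + 1 :=
    Nat.exists_eq_succ_of_ne_zero (by rintro rfl; linarith)
  have hle : ∑ j ∈ range m, T (j + 1) ≤ ∑ j ∈ range m, if j < a then (1 : ℝ) else 0 := by
    refine sum_le_sum fun j _ => ?_
    split_ifs with hj
    · exact h0 ▸ hanti (Nat.zero_le _)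
    · exact (hanti (by omega)).trans hk
  have hcard : #{j ∈ range m | j < a} ≤ a :=
    (card_le_card fun j hj => mem_range.2 (mem_filter.1 hj).2).trans (card_range a).le
  rw [← sum_filter, sum_const, nsmul_eq_mul, mul_one] at hle
  have : a + 1 ≤ a := by exact_mod_cast (hmean.trans hle).trans (Nat.cast_le.2 hcard)
  omega

lemma exists_half_lt_pow_and_half_le {r : ℝ} (hr : 0 ≤ r) (hr1 : r < 1) :
    ∃ L : ℕ, 1 / 2 < r ^ L ∧ 1 / 2 ≤ (L + 1) * (1 - r) := by
  have hex : ∃ n : ℕ, r ^ n ≤ 1 / 2 :=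
    (exists_pow_lt_of_lt_one one_half_pos hr1).imp fun _ => le_of_lt
  classical
  obtain ⟨L, hL⟩ : ∃ L, Nat.find hex = L + 1 :=
    Nat.exists_eq_succ_of_ne_zero fun h => by
      have := Nat.find_spec hex
      rw [h] at this
      norm_num at this
  refine ⟨L, not_le.1 (Nat.find_min hex (by omega)), ?_⟩
  have hspec : r ^ (L + 1) ≤ 1 / 2 := hL ▸ Nat.find_spec hex
  have hbernoulli := one_add_mul_le_pow (show -2 ≤ r - 1 by linarith) (L + 1)
  rw [add_sub_cancel] at hbernoulli
  push_cast at hbernoulli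
  linarith

lemma sum_mul_le_of_geometric_decay {T : ℕ → ℝ} {q r x : ℝ} (hr : 0 ≤ r) (hr1 : r < 1) (hq : 0 ≤ q)
    (hdecay : ∀ t, T t * x ≤ q * r ^ t) (n : ℕ) : (∑ t ∈ range n, T t) * x * (1 - r) ≤ q := by
  calc (∑ t ∈ range n, T t) * x * (1 - r) ≤ (∑ t ∈ range n, q * r ^ t) * (1 - r) := by
        rw [sum_mul]
        exact mul_le_mul_of_nonneg_right (sum_le_sum fun t _ => hdecay t) (by linarith)
    _ = q * (1 - r ^ n) := by rw [← mul_sum, mul_assoc, geom_sum_mul_neg]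
    _ ≤ q := mul_le_of_le_one_right hq (by linarith [pow_nonneg hr n])

lemma IsLogConcave.exists_geometric_majorant {T : ℕ → ℝ} {k : ℕ} (hT : IsLogConcave T)
    (h0 : T 0 = 1) (hanti : Antitone T) (hk : 0 < T k) (hk1 : T k < 1) :
    ∃ r, 0 < r ∧ r < 1 ∧ ∀ j, T j * r ^ k ≤ T k * r ^ j := by
  obtain ⟨a, rfl⟩ : ∃ a, k = a + 1 :=
    Nat.exists_eq_succ_of_ne_zero (by rintro rfl; linarith)
  have ha : 0 < T a := hk.trans_le (hanti a.le_succ)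
  obtain ⟨r, hra⟩ : ∃ r, T (a + 1) = r * T a := ⟨T (a + 1) / T a, by field_simp⟩
  have hr : 0 < r := pos_of_mul_pos_left (hra ▸ hk) ha.le
  have hdom (j : ℕ) : T j * r ^ (a + 1) ≤ T (a + 1) * r ^ j := by
    rw [hra, pow_succ]
    nlinarith [hT.mul_pow_le ha hr hra j]
  refine ⟨r, hr, ?_, hdom⟩
  by_contra! h
  have := hdom 0
  rw [h0, pow_zero] at this
  linarith [one_le_pow₀ h (n := a + 1)]

-- With `r` the ratio of `T` just before `k` and `r ^ L` about `1 / 2`, log-concavity bounds the sum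
-- from `k - L` on by a geometric series, hence by less than `L + 1` if `T k < 1 / 4`.
lemma quarter_le_of_isLogConcave {T : ℕ → ℝ} {m k : ℕ} (hT : IsLogConcave T) (h0 : T 0 = 1)
    (hanti : Antitone T) (hnonneg : ∀ j, 0 ≤ T j)
    (hmean : (k : ℝ) ≤ ∑ j ∈ range m, T (j + 1)) : 1 / 4 ≤ T k := by
  by_contra! hlt
  have hk : 0 < T k := pos_of_le_sum_tail h0 hanti hmean
  obtain ⟨r, hr, hr1, hdom⟩ := hT.exists_geometric_majorant h0 hanti hk (by linarith)
  obtain ⟨a, rfl⟩ : ∃ a, k = a + 1 :=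
    Nat.exists_eq_succ_of_ne_zero (by rintro rfl; linarith)
  have hpow : r ^ (a + 1) < 1 / 4 := by
    have := hdom 0
    rw [h0, pow_zero] at this
    linarith
  obtain ⟨L, hL, hLr⟩ := exists_half_lt_pow_and_half_le hr.le hr1
  have hLa : L ≤ a := by
    by_contra! h
    linarith [pow_le_pow_of_le_one hr.le hr1.le (show a + 1 ≤ L from h)]
  have hdecay (t : ℕ) : T (a - L + t + 1) * r ^ L ≤ T (a + 1) * r ^ t := by
    refine le_of_mul_le_mul_right ?_ (pow_pos hr (a - L + 1))
    calc T (a - L + t + 1) * r ^ L * r ^ (a - L + 1) = T (a - L + t + 1) * r ^ (a + 1) := by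
          rw [mul_assoc, ← pow_add]
          congr 2
          omega
      _ ≤ T (a + 1) * r ^ (a - L + t + 1) := hdom _
      _ = T (a + 1) * r ^ t * r ^ (a - L + 1) := by ring
  have hhead : ∑ j ∈ range (a - L), T (j + 1) ≤ a - L := by
    refine (sum_le_card_nsmul _ _ 1 fun j _ => h0 ▸ hanti (Nat.zero_le _)).trans ?_
    rw [card_range, nsmul_eq_mul, mul_one, Nat.cast_sub hLa]
  have htail : ∑ t ∈ range m, T (a - L + t + 1) < L + 1 := by
    have := sum_mul_le_of_geometric_decay hr.le hr1 hk.le hdecay m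
    by_contra! h
    nlinarith [mul_le_mul h hL.le (by norm_num) (by linarith)]
  have hsplit : ∑ j ∈ range m, T (j + 1) ≤
      ∑ j ∈ range (a - L), T (j + 1) + ∑ t ∈ range m, T (a - L + t + 1) := by
    rw [← sum_range_add fun j => T (j + 1)]
    exact sum_le_sum_of_subset_of_nonneg (range_subset_range.2 (Nat.le_add_left _ _))
      fun _ _ _ => hnonneg _
  push_cast at hmean
  linarith

lemma sum_range_sum_Ico_succ (p : ℕ → ℝ) (n : ℕ) :
    ∑ l ∈ range n, ∑ j ∈ Ico (l + 1) n, p j = ∑ j ∈ range n, j * p j := by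
  rw [sum_comm' (t' := range n) (s' := range) fun l j => by simp only [mem_range, mem_Ico]; omega]
  simp only [sum_const, card_range, nsmul_eq_mul]

lemma quarter_le_sum_Ico_of_isLogConcave {p : ℕ → ℝ} {n k : ℕ} (hp : IsLogConcave p)
    (hp0 : ∀ j, 0 ≤ p j) (hmean : k * ∑ j ∈ range n, p j ≤ ∑ j ∈ range n, j * p j) :
    (∑ j ∈ range n, p j) / 4 ≤ ∑ j ∈ Ico k n, p j := by
  obtain hP | hP := (sum_nonneg fun j _ => hp0 j : 0 ≤ ∑ j ∈ range n, p j).eq_or_lt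
  · rw [← hP, zero_div]
    exact sum_nonneg fun j _ => hp0 j
  have := quarter_le_of_isLogConcave (T := fun l => (∑ j ∈ Ico l n, p j) / ∑ j ∈ range n, p j)
    (m := n) (k := k)
    (fun i j hij => by
      simp only [div_mul_div_comm]
      exact div_le_div_of_nonneg_right (hp.tail hp0 n hij) (mul_pos hP hP).le)
    (by simp only [← range_eq_Ico]; exact div_self hP.ne')
    (fun i j hij => div_le_div_of_nonneg_right (sum_le_sum_of_subset_of_nonneg
      (Ico_subset_Ico_left hij) fun _ _ _ => hp0 _) hP.le)
    (fun l => div_nonneg (sum_nonneg fun j _ => hp0 j) hP.le)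
    (by rw [← sum_div, le_div_iff₀ hP, sum_range_sum_Ico_succ]; exact hmean)
  rw [le_div_iff₀ hP] at this
  linarith

lemma choose_succ_mul_choose_le {K a b : ℕ} (h : b ≤ a) :
    K.choose (a + 1) * K.choose b ≤ K.choose a * K.choose (b + 1) := by
  obtain hK | hK := Nat.lt_or_ge K (a + 1)
  · rw [Nat.choose_eq_zero_of_lt hK, zero_mul]
    exact Nat.zero_le _
  · have ha := Nat.choose_succ_right_eq K a
    have hb := Nat.choose_succ_right_eq K b
    refine Nat.le_of_mul_le_mul_right (c := (a + 1) * (b + 1)) ?_ (by positivity)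
    calc K.choose (a + 1) * K.choose b * ((a + 1) * (b + 1))
        = (K.choose (a + 1) * (a + 1)) * (K.choose b * (b + 1)) := by ring
      _ = K.choose a * K.choose b * ((K - a) * (b + 1)) := by rw [ha]; ring
      _ ≤ K.choose a * K.choose b * ((K - b) * (a + 1)) :=
        Nat.mul_le_mul_left _ (Nat.mul_le_mul (by omega) (by omega))
      _ = K.choose a * (a + 1) * (K.choose b * (K - b)) := by ring
      _ = _ := by rw [← hb]; ring

end LogConcave

section Hypergeometric

variable {V : Type*} [Fintype V] [DecidableEq V] {I : Finset V} {s j k : ℕ}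

lemma card_filter_inter_eq {A : Finset V} (hA : A ⊆ I) (hs : #A ≤ s) :
    #{S ∈ (univ : Finset V).powersetCard s | S ∩ I = A} =
      (Fintype.card V - #I).choose (s - #A) := by
  rw [← card_compl, ← card_powersetCard]
  refine card_nbij' (· \ I) (A ∪ ·) ?_ ?_ ?_ ?_
  · intro S hS
    simp only [coe_filter, Set.mem_ofPred_eq, mem_powersetCard_univ] at hS
    have := card_sdiff_add_card_inter S I
    rw [hS.1, hS.2] at this
    have hcard : #(S \ I) = s - #A := by omega
    exact mem_powersetCard.2 ⟨fun v hv => mem_compl.2 (mem_sdiff.1 hv).2, hcard⟩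
  · intro B hB
    obtain ⟨hBI, hBs⟩ := mem_powersetCard.1 hB
    have hdisj : Disjoint I B := disjoint_compl_right.mono_right hBI
    simp only [coe_filter, Set.mem_ofPred_eq, mem_powersetCard_univ]
    refine ⟨?_, ?_⟩
    · rw [card_union_of_disjoint (hdisj.mono_left hA), hBs]
      omega
    · rw [union_inter_distrib_right, inter_eq_left.2 hA, disjoint_iff_inter_eq_empty.1 hdisj.symm,
        union_empty]
  · intro S hS
    simp only [coe_filter, Set.mem_ofPred_eq] at hS
    simp only [← hS.2, union_comm (S ∩ I), sdiff_union_inter]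
  · intro B hB
    have hdisj : Disjoint I B := disjoint_compl_right.mono_right (mem_powersetCard.1 hB).1
    simp only [union_sdiff_distrib, sdiff_eq_empty_iff_subset.2 hA, empty_union,
      sdiff_eq_self_of_disjoint hdisj.symm]

open Classical in
lemma card_filter_card_inter_eq_and (hj : j ≤ s) (Q : Finset V → Prop) :
    #{S ∈ (univ : Finset V).powersetCard s | #(S ∩ I) = j ∧ Q (S ∩ I)} =
      #{A ∈ I.powersetCard j | Q A} * (Fintype.card V - #I).choose (s - j) := by
  rw [card_eq_sum_card_fiberwise (f := (· ∩ I)) (t := {A ∈ I.powersetCard j | Q A})]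
  · refine sum_const_nat fun A hA => ?_
    rw [mem_filter, mem_powersetCard] at hA
    rw [← hA.1.2, ← card_filter_inter_eq hA.1.1 (by omega), filter_filter]
    congr 1
    refine filter_congr fun S _ => ⟨And.right, ?_⟩
    rintro rfl
    exact ⟨⟨rfl, hA.2⟩, rfl⟩
  · intro S hS
    simp only [coe_filter, Set.mem_ofPred_eq] at hS
    simp only [coe_filter, Set.mem_ofPred_eq, mem_powersetCard]
    exact ⟨⟨inter_subset_right, hS.2.1⟩, hS.2.2⟩

lemma card_filter_card_inter_eq (hj : j ≤ s) :
    #{S ∈ (univ : Finset V).powersetCard s | #(S ∩ I) = j} =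
      (#I).choose j * (Fintype.card V - #I).choose (s - j) := by
  classical
  simpa using card_filter_card_inter_eq_and (I := I) hj fun _ => True

lemma card_inter_mem_range {S : Finset V} (hS : S ∈ (univ : Finset V).powersetCard s)
    (I : Finset V) : #(S ∩ I) ∈ range (s + 1) :=
  mem_range.2 <| Nat.lt_succ_of_le <|
    (card_le_card inter_subset_left).trans (mem_powersetCard_univ.1 hS).le

lemma isLogConcave_card_filter_card_inter_eq (I : Finset V) (s : ℕ) :
    IsLogConcave fun j => #{S ∈ (univ : Finset V).powersetCard s | #(S ∩ I) = j} := by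
  intro i j hij
  obtain hi | hi := Nat.lt_or_ge s (i + 1)
  · have : {S ∈ (univ : Finset V).powersetCard s | #(S ∩ I) = i + 1} = ∅ := by
      refine filter_eq_empty_iff.2 fun S hS h => ?_
      have := mem_range.1 (h ▸ card_inter_mem_range hS I)
      omega
    simp only [this, card_empty, Nat.cast_zero, zero_mul]
    positivity
  · have hI := choose_succ_mul_choose_le (K := #I) hij
    have hIc := choose_succ_mul_choose_le (K := Fintype.card V - #I)
      (show s - (i + 1) ≤ s - (j + 1) by omega)
    rw [show s - (j + 1) + 1 = s - j by omega, show s - (i + 1) + 1 = s - i by omega] at hIc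
    simp only [card_filter_card_inter_eq hi, card_filter_card_inter_eq (show j ≤ s by omega),
      card_filter_card_inter_eq (show i ≤ s by omega),
      card_filter_card_inter_eq (show j + 1 ≤ s by omega)]
    have := Nat.mul_le_mul hI hIc
    norm_cast
    linarith

lemma sum_card_inter_powersetCard (I : Finset V) (s : ℕ) :
    (∑ S ∈ (univ : Finset V).powersetCard s, (#(S ∩ I) : ℝ)) =
      s * I.dens * (Fintype.card V).choose s := by
  obtain _ | t := s
  · simp
  obtain hV | hV := isEmpty_or_nonempty V
  · simp [eq_empty_of_isEmpty]
  obtain ⟨n, hn⟩ : ∃ n, Fintype.card V = n + 1 :=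
    Nat.exists_eq_succ_of_ne_zero Fintype.card_ne_zero
  have hfiber : ∀ v ∈ I, #{S ∈ (univ : Finset V).powersetCard (t + 1) | v ∈ S} = n.choose t := by
    intro v _
    have := card_filter_powersetCard_subset {v} univ (t + 1) (subset_univ _) (by simp)
    simpa [hn] using this
  have hsum : ∑ S ∈ (univ : Finset V).powersetCard (t + 1), #(S ∩ I) = #I * n.choose t := by
    simpa only [inter_comm] using sum_card_inter hfiber
  have hchoose : ((n : ℝ) + 1) * n.choose t = (n + 1).choose (t + 1) * (t + 1) := by
    exact_mod_cast Nat.add_one_mul_choose_eq n t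
  rw [← Nat.cast_sum, hsum, nnratCast_dens, hn]
  push_cast
  field_simp
  rw [mul_assoc, mul_comm _ ((n : ℝ) + 1), hchoose]
  ring

lemma quarter_le_sum_card_filter_card_inter_eq (hk : (k : ℝ) ≤ s * I.dens) :
    ((Fintype.card V).choose s : ℝ) / 4 ≤
      ∑ j ∈ Ico k (s + 1), (#{S ∈ (univ : Finset V).powersetCard s | #(S ∩ I) = j} : ℝ) := by
  have hmaps : ∀ S ∈ (univ : Finset V).powersetCard s, #(S ∩ I) ∈ range (s + 1) :=
    fun S hS => card_inter_mem_range hS I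
  have htot : ∑ j ∈ range (s + 1),
      (#{S ∈ (univ : Finset V).powersetCard s | #(S ∩ I) = j} : ℝ) =
        (Fintype.card V).choose s := by
    rw [← card_univ, ← card_powersetCard, card_eq_sum_card_fiberwise hmaps, Nat.cast_sum]
  have hmean : ∑ j ∈ range (s + 1),
      (j : ℝ) * #{S ∈ (univ : Finset V).powersetCard s | #(S ∩ I) = j} =
        s * I.dens * (Fintype.card V).choose s := by
    rw [← sum_card_inter_powersetCard, ← sum_fiberwise_of_maps_to hmaps]
    refine sum_congr rfl fun j _ => ?_
    rw [sum_congr rfl fun S hS => by rw [(mem_filter.1 hS).2], sum_const, nsmul_eq_mul, mul_comm]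
  rw [← htot]
  refine quarter_le_sum_Ico_of_isLogConcave (isLogConcave_card_filter_card_inter_eq I s)
    (fun j => by positivity) ?_
  rw [htot, hmean]
  gcongr

end Hypergeometric

section SparseSubsets

lemma half_card_le_card_filter_le_two_mul {ι : Type*} {P : Finset ι} {f : ι → ℝ} {m : ℝ}
    (hf : ∀ i ∈ P, 0 ≤ f i) (hm : ∑ i ∈ P, f i ≤ m * #P) :
    (#P : ℝ) / 2 ≤ #{i ∈ P | f i ≤ 2 * m} := by
  by_contra! h
  have hsplit : (#{i ∈ P | f i ≤ 2 * m} : ℝ) + #{i ∈ P | ¬ f i ≤ 2 * m} = #P := by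
    exact_mod_cast card_filter_add_card_filter_not (s := P) (fun i => f i ≤ 2 * m)
  have hbad : (#P : ℝ) / 2 < #{i ∈ P | ¬ f i ≤ 2 * m} := by linarith
  have hmarkov : (#{i ∈ P | ¬ f i ≤ 2 * m} : ℝ) * (2 * m) < ∑ i ∈ P, f i := by
    rw [← nsmul_eq_mul, ← sum_const]
    have hne : {i ∈ P | ¬ f i ≤ 2 * m}.Nonempty := card_pos.1 <| by
      exact_mod_cast (show (0 : ℝ) ≤ #P / 2 by positivity).trans_lt hbad
    exact (sum_lt_sum_of_nonempty hne fun i hi => not_le.1 (mem_filter.1 hi).2).trans_le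
      (sum_le_sum_of_subset_of_nonneg (filter_subset _ _) fun i hi _ => hf i hi)
  have hm0 : 0 ≤ m := by
    by_contra! hneg
    have hP : (0 : ℝ) < #P := by
      linarith [(Nat.cast_nonneg _ : (0 : ℝ) ≤ #{i ∈ P | f i ≤ 2 * m})]
    linarith [sum_nonneg hf, mul_neg_of_neg_of_pos hneg hP]
  nlinarith

variable {V : Type*} {G : SimpleGraph V}

lemma half_choose_le_card_filter_adjPairs_le (I : Finset V) (j : ℕ) :
    ((#I).choose j : ℝ) / 2 ≤
      #{A ∈ I.powersetCard j | (adjPairs G A A : ℝ) ≤ 2 * ((j / #I) ^ 2 * adjPairs G I I)} := by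
  obtain hj | hj := Nat.lt_or_ge (#I) j
  · simp [Nat.choose_eq_zero_of_lt hj]
  rw [← card_powersetCard]
  refine half_card_le_card_filter_le_two_mul (fun _ _ => by positivity) ?_
  rw [card_powersetCard]
  exact sum_powersetCard_adjPairs_self_le hj

lemma exists_subset_adjPairs_self_le {B : Finset V} {w : ℕ} (hw : w ≤ #B) :
    ∃ W ⊆ B, #W = w ∧ (adjPairs G W W : ℝ) ≤ (w / #B) ^ 2 * adjPairs G B B := by
  have hsum := sum_powersetCard_adjPairs_self_le (G := G) hw
  rw [← card_powersetCard, mul_comm _ (_ : ℝ), ← nsmul_eq_mul, ← sum_const] at hsum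
  obtain ⟨W, hW, hle⟩ := exists_le_of_sum_le (powersetCard_nonempty.2 hw) hsum
  exact ⟨W, (mem_powersetCard.1 hW).1, (mem_powersetCard.1 hW).2, hle⟩

variable [DecidableEq V] in
lemma exists_sparse_subset_of_le_card {I S : Finset V} {k j : ℕ} (hkj : k ≤ j)
    (hj : #(S ∩ I) = j)
    (hS : (adjPairs G (S ∩ I) (S ∩ I) : ℝ) ≤ 2 * ((j / #I) ^ 2 * adjPairs G I I)) :
    ∃ J ⊆ S, #J = k ∧ (adjPairs G J J : ℝ) ≤ 2 * ((k / #I) ^ 2 * adjPairs G I I) := by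
  obtain ⟨J, hJ, hJk, hle⟩ := exists_subset_adjPairs_self_le (G := G) (hkj.trans_eq hj.symm)
  refine ⟨J, hJ.trans inter_subset_left, hJk, hle.trans ?_⟩
  rw [hj]
  calc ((k : ℝ) / j) ^ 2 * adjPairs G (S ∩ I) (S ∩ I)
      ≤ ((k : ℝ) / j) ^ 2 * (2 * ((j / #I) ^ 2 * adjPairs G I I)) := by gcongr
    _ = 2 * (((k : ℝ) / j * (j / #I)) ^ 2 * adjPairs G I I) := by ring
    _ ≤ 2 * ((k / #I) ^ 2 * adjPairs G I I) := by
      gcongr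
      obtain rfl | hj0 := Nat.eq_zero_or_pos j
      · simp only [Nat.cast_zero, div_zero, zero_mul]
        positivity
      · rw [div_mul_div_cancel₀ (by positivity)]

variable [Fintype V]

open Classical in
lemma choose_div_eight_le_card_filter {I : Finset V} {s k : ℕ} (hk : (k : ℝ) ≤ s * I.dens) :
    ((Fintype.card V).choose s : ℝ) / 8 ≤ #{S ∈ (univ : Finset V).powersetCard s |
      ∃ J ⊆ S, #J = k ∧ (adjPairs G J J : ℝ) ≤ 2 * ((k / #I) ^ 2 * adjPairs G I I)} := by
  set 𝒮 := {S ∈ (univ : Finset V).powersetCard s |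
    ∃ J ⊆ S, #J = k ∧ (adjPairs G J J : ℝ) ≤ 2 * ((k / #I) ^ 2 * adjPairs G I I)}
  have hslices : ∑ j ∈ Ico k (s + 1), (#{S ∈ 𝒮 | #(S ∩ I) = j} : ℝ) ≤ #𝒮 := by
    rw [card_eq_sum_card_fiberwise (t := range (s + 1)) fun S hS =>
      card_inter_mem_range (mem_filter.1 hS).1 I, Nat.cast_sum, range_eq_Ico]
    exact sum_le_sum_of_subset_of_nonneg (Ico_subset_Ico_left (Nat.zero_le k))
      fun _ _ _ => by positivity
  have hhalf : ∀ j ∈ Ico k (s + 1),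
      (#{S ∈ (univ : Finset V).powersetCard s | #(S ∩ I) = j} : ℝ) / 2 ≤
        #{S ∈ 𝒮 | #(S ∩ I) = j} := by
    intro j hj
    obtain ⟨hkj, hjs⟩ := mem_Ico.1 hj
    have hjs : j ≤ s := Nat.le_of_lt_succ hjs
    calc (#{S ∈ (univ : Finset V).powersetCard s | #(S ∩ I) = j} : ℝ) / 2
        = (#I).choose j / 2 * (Fintype.card V - #I).choose (s - j) := by
          rw [card_filter_card_inter_eq hjs]
          push_cast
          ring
      _ ≤ #{A ∈ I.powersetCard j | (adjPairs G A A : ℝ) ≤ 2 * ((j / #I) ^ 2 * adjPairs G I I)} *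
            (Fintype.card V - #I).choose (s - j) := by
          gcongr
          exact half_choose_le_card_filter_adjPairs_le I j
      _ = #{S ∈ (univ : Finset V).powersetCard s | #(S ∩ I) = j ∧
            (adjPairs G (S ∩ I) (S ∩ I) : ℝ) ≤ 2 * ((j / #I) ^ 2 * adjPairs G I I)} := by
          rw [card_filter_card_inter_eq_and hjs fun A =>
            (adjPairs G A A : ℝ) ≤ 2 * ((j / #I) ^ 2 * adjPairs G I I), Nat.cast_mul]
      _ ≤ #{S ∈ 𝒮 | #(S ∩ I) = j} := by
          refine Nat.cast_le.2 (card_le_card fun S hS => ?_)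
          obtain ⟨hSs, hSj, hS⟩ := mem_filter.1 hS
          exact mem_filter.2 ⟨mem_filter.2 ⟨hSs, exists_sparse_subset_of_le_card hkj hSj hS⟩, hSj⟩
  have := sum_le_sum hhalf
  rw [← sum_div] at this
  linarith [quarter_le_sum_card_filter_card_inter_eq hk]

end SparseSubsets

section EditDistance

lemma two_mul_ncard_edgeSet {W : Type*} [Fintype W] (H : SimpleGraph W) :
    2 * H.edgeSet.ncard = adjPairs H univ univ := by
  classical
  rw [← SimpleGraph.coe_edgeFinset, Set.ncard_coe_finset, SimpleGraph.two_mul_card_edgeFinset]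
  simp only [adjPairs, SimpleGraph.interedges, Rel.interedges, univ_product_univ]

lemma adjPairs_map {W V : Type*} {H : SimpleGraph W} {G : SimpleGraph V} (f : H ↪g G)
    (A B : Finset W) :
    adjPairs G (A.map f.toEmbedding) (B.map f.toEmbedding) = adjPairs H A B := by
  classical
  simp only [adjPairs_eq_sum_degInto, degInto, card_filter, sum_map, RelEmbedding.coe_toEmbedding,
    f.map_adj_iff]

lemma two_mul_ncard_edgeSet_induce {V : Type*} (G : SimpleGraph V) (B : Finset V) :
    2 * (G.induce (B : Set V)).edgeSet.ncard = adjPairs G B B := by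
  rw [two_mul_ncard_edgeSet, ← adjPairs_map (SimpleGraph.Embedding.induce (B : Set V))]
  congr 1 <;> (ext v; simp)

lemma adjPairs_self_add_card_le {V : Type*} (G : SimpleGraph V) (B : Finset V) :
    adjPairs G B B + #B ≤ #B * #B := by
  classical
  have : G.interedges B B ⊆ B.offDiag := fun e he => by
    rw [SimpleGraph.mem_interedges_iff] at he
    exact mem_offDiag.2 ⟨he.1, he.2.1, he.2.2.ne⟩
  have hle := card_le_card this
  rw [offDiag_card] at hle
  have := Nat.le_mul_self #B
  rw [adjPairs]
  omega

variable {n : ℕ} {ρ ε : ℝ} {G : SimpleGraph (Fin n)}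

lemma adjPairs_le_two_mul_editDist {H : SimpleGraph (Fin n)} {I : Finset (Fin n)}
    (hI : H.IsIndepSet (I : Set (Fin n))) : adjPairs G I I ≤ 2 * editDist G H := by
  classical
  rw [← two_mul_ncard_edgeSet_induce]
  refine Nat.mul_le_mul_left 2 ?_
  rw [← Set.ncard_image_of_injective _
    (Sym2.map.injective (Subtype.val_injective (p := (· ∈ (I : Set (Fin n))))))]
  refine Set.ncard_le_ncard ?_ (Set.toFinite _)
  rintro _ ⟨e, he, rfl⟩
  induction e using Sym2.ind with
  | _ a b =>
    rw [SimpleGraph.mem_edgeSet, SimpleGraph.comap_adj] at he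
    have hab : (a : Fin n) ≠ b := he.ne
    exact Set.mem_symmDiff.2 (Or.inl ⟨by simpa using he, by simpa using hI a.2 b.2 hab⟩)

lemma exists_isIndepSet_two_mul_editDist (G : SimpleGraph (Fin n)) (B : Finset (Fin n)) :
    ∃ H : SimpleGraph (Fin n), H.IsIndepSet (B : Set (Fin n)) ∧
      2 * editDist G H = adjPairs G B B := by
  classical
  refine ⟨G \ (G.induce (B : Set (Fin n))).spanningCoe, ?_, ?_⟩
  · intro a ha b hb _ hab
    rw [SimpleGraph.sdiff_adj] at hab
    exact hab.2 (by simpa [SimpleGraph.map_adj] using ⟨hab.1, ha, hb⟩)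
  · have hle : (G.induce (B : Set (Fin n))).spanningCoe.edgeSet ⊆ G.edgeSet :=
      SimpleGraph.edgeSet_mono (SimpleGraph.spanningCoe_induce_le G _)
    rw [editDist, SimpleGraph.edgeSet_sdiff, symmDiff_of_ge Set.sdiff_subset,
      Set.sdiff_sdiff_cancel_left hle, ← two_mul_ncard_edgeSet_induce, SimpleGraph.edgeSet_map,
      Set.ncard_image_of_injective _ (Function.Embedding.injective _)]

lemma exists_adjPairs_le_of_isClose (hG : IsClose (IndepSetProperty n ρ) ε G) :
    ∃ I : Finset (Fin n), ρ * n ≤ #I ∧ (adjPairs G I I : ℝ) ≤ 2 * (ε * n ^ 2) := by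
  obtain ⟨H, ⟨I, hI, hIρ⟩, hH⟩ := hG
  have : (adjPairs G I I : ℝ) ≤ 2 * editDist G H := by
    exact_mod_cast adjPairs_le_two_mul_editDist hI
  exact ⟨I, hIρ, by linarith⟩

lemma le_adjPairs_of_isFar (hG : IsFar (IndepSetProperty n ρ) ε G) {B : Finset (Fin n)}
    (hB : ρ * n ≤ #B) : 2 * ε * n ^ 2 ≤ adjPairs G B B := by
  obtain ⟨H, hH, hd⟩ := exists_isIndepSet_two_mul_editDist G B
  have hfar := hG H ⟨B, hH, hB⟩
  have : (2 : ℝ) * editDist G H = adjPairs G B B := by exact_mod_cast hd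
  linarith

lemma not_hasSparseSet_of_isFar (hG : IsFar (IndepSetProperty n ρ) ε G) :
    ¬ HasSparseSet G ρ ε := by
  rintro ⟨B, hB, hlt⟩
  rw [Fintype.card_fin] at hB hlt
  exact hlt.not_ge (le_adjPairs_of_isFar hG hB)

lemma lt_half_and_le_sq_of_isFar (hn : 0 < n) (hρ : 0 < ρ) (hρ1 : ρ ≤ 1) (hε : 0 < ε)
    (hG : IsFar (IndepSetProperty n ρ) ε G) : ε < 1 / 2 ∧ ε ≤ ρ ^ 2 := by
  have hn0 : (0 : ℝ) < n := by exact_mod_cast hn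
  have hceil : ⌈ρ * n⌉₊ ≤ n := Nat.ceil_le.2 (mul_le_of_le_one_left hn0.le hρ1)
  obtain ⟨B, -, hB⟩ := exists_subset_card_eq (s := (univ : Finset (Fin n)))
    (hceil.trans_eq (card_fin n).symm)
  have hle : ρ * n ≤ #B := hB ▸ Nat.le_ceil _
  have hlt : (#B : ℝ) < ρ * n + 1 := hB ▸ Nat.ceil_lt_add_one (by positivity)
  have hBn : (#B : ℝ) ≤ n := by exact_mod_cast hB.trans_le hceil
  have hadj : 2 * ε * n ^ 2 + #B ≤ #B * #B :=
    (add_le_add_left (le_adjPairs_of_isFar hG hle) _).trans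
      (by exact_mod_cast adjPairs_self_add_card_le G B)
  have hB0 : (0 : ℝ) < #B := (by positivity : 0 < ρ * n).trans_le hle
  refine ⟨lt_of_mul_lt_mul_right (a := (n : ℝ) ^ 2) ?_ (by positivity),
    le_of_mul_le_mul_right (a := (n : ℝ) ^ 2) ?_ (by positivity)⟩
  · nlinarith
  · have hB2 : (2 : ℝ) ≤ #B := by
      have : (1 : ℝ) < #B := by
        by_contra! h
        nlinarith [(by positivity : 0 < ε * (n : ℝ) ^ 2)]
      exact_mod_cast (show 1 < #B by exact_mod_cast this)
    have : (#B : ℝ) * (#B - 1) ≤ 2 * (ρ * n) * (ρ * n) := by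
      gcongr <;> linarith
    linarith

end EditDistance

section AcceptanceProbability

variable {n s k : ℕ} {ρ ε m : ℝ} {G : SimpleGraph (Fin n)}

lemma exists_sparse_finset_induce_iff (G : SimpleGraph (Fin n)) (S : Finset (Fin n)) (k : ℕ)
    (m : ℝ) :
    (∃ J : Finset (S : Set (Fin n)), #J = k ∧
      (((G.induce (S : Set (Fin n))).induce
        (J : Set (S : Set (Fin n)))).edgeSet.ncard : ℝ) ≤ m) ↔
    ∃ J ⊆ S, #J = k ∧ (adjPairs G J J : ℝ) ≤ 2 * m := by
  set f := SimpleGraph.Embedding.induce (G := G) (S : Set (Fin n))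
  have hedges (J : Finset (S : Set (Fin n))) :
      2 * (((G.induce (S : Set (Fin n))).induce (J : Set (S : Set (Fin n)))).edgeSet.ncard : ℝ) =
        adjPairs G (J.map f.toEmbedding) (J.map f.toEmbedding) := by
    rw [adjPairs_map, ← two_mul_ncard_edgeSet_induce]
    push_cast
    rfl
  constructor
  · rintro ⟨J, hJ, hm⟩
    refine ⟨J.map f.toEmbedding, fun v hv => ?_, (card_map _).trans hJ, ?_⟩
    · obtain ⟨w, -, rfl⟩ := mem_map.1 hv
      exact w.2
    · rw [← hedges]
      linarith
  · rintro ⟨J, hJ, hk, hm⟩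
    have hmap : (J.subtype (· ∈ (S : Set (Fin n)))).map f.toEmbedding = J :=
      (subtype_map _).trans (filter_eq_self.2 fun v hv => hJ hv)
    refine ⟨J.subtype (· ∈ (S : Set (Fin n))), by rw [← card_map f.toEmbedding, hmap, hk], ?_⟩
    have := hedges (J.subtype (· ∈ (S : Set (Fin n))))
    rw [hmap] at this
    linarith

open Classical in
lemma acceptProb_sparseSubsetRule (G : SimpleGraph (Fin n)) (s k : ℕ) (m : ℝ) :
    acceptProb s (sparseSubsetRule n k m) G =
      #{S ∈ (univ : Finset (Fin n)).powersetCard s |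
        ∃ J ⊆ S, #J = k ∧ (adjPairs G J J : ℝ) ≤ 2 * m} / (n.choose s : ℝ) := by
  rw [acceptProb, card_filter]
  push_cast
  congr 1
  refine sum_congr rfl fun S _ => ?_
  rw [sparseSubsetRule]
  simp only [exists_sparse_finset_induce_iff]
  split_ifs <;> rfl

lemma le_acceptProb_of_isClose (hn : 0 < n) (hs : s ≤ n) (hρ : 0 < ρ)
    (hG : IsClose (IndepSetProperty n ρ) ε G) :
    1 / 8 ≤ acceptProb s (sparseSubsetRule n ⌊ρ * s⌋₊ (2 * ε * s ^ 2)) G := by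
  classical
  obtain ⟨I, hI, hadj⟩ := exists_adjPairs_le_of_isClose hG
  have hn0 : (0 : ℝ) < n := by exact_mod_cast hn
  have hI0 : (0 : ℝ) < #I := (by positivity : 0 < ρ * n).trans_le hI
  have hfloor : (⌊ρ * s⌋₊ : ℝ) ≤ ρ * s := Nat.floor_le (by positivity)
  have hk : (⌊ρ * s⌋₊ : ℝ) * n ≤ s * #I :=
    calc (⌊ρ * s⌋₊ : ℝ) * n ≤ ρ * s * n := by gcongr
      _ = s * (ρ * n) := by ring
      _ ≤ s * #I := by gcongr
  have hchoose : (0 : ℝ) < n.choose s := by exact_mod_cast Nat.choose_pos hs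
  have h8 := choose_div_eight_le_card_filter (G := G) (I := I) (s := s) (k := ⌊ρ * s⌋₊) (by
    rw [nnratCast_dens, Fintype.card_fin, ← mul_div_assoc, le_div_iff₀ hn0]
    exact hk)
  rw [Fintype.card_fin] at h8
  rw [acceptProb_sparseSubsetRule, le_div_iff₀ hchoose]
  refine (by linarith : _ ≤ (n.choose s : ℝ) / 8).trans (h8.trans (Nat.cast_le.2 (card_le_card ?_)))
  refine monotone_filter_right _ fun S _ => ?_
  rintro ⟨J, hJ, hJk, hJadj⟩
  refine ⟨J, hJ, hJk, hJadj.trans (mul_le_mul_of_nonneg_left ?_ two_pos.le)⟩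
  calc ((⌊ρ * s⌋₊ : ℝ) / #I) ^ 2 * adjPairs G I I ≤ ((s : ℝ) / n) ^ 2 * (2 * (ε * n ^ 2)) := by
        gcongr ?_ ^ 2 * ?_
        rwa [div_le_div_iff₀ hI0 hn0]
    _ = 2 * ε * s ^ 2 := by field_simp

end AcceptanceProbability

section Parameters

/-- The tolerance `ε₁` of the tester. -/
noncomputable def tolerance (ε : ℝ) : ℝ := ε / (10 ^ 10 * Real.logb 2 (1 / ε) ^ 4)

/-- The number of vertices that the tester samples. -/
noncomputable def sampleSize (ρ ε : ℝ) : ℕ :=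
  ⌈10 ^ 14 * (ρ ^ 3 * Real.logb 2 (1 / ε) ^ 5 / ε ^ 2)⌉₊

variable {ε ρ : ℝ}

lemma one_lt_logb_inv (hε : 0 < ε) (hε2 : ε < 1 / 2) : 1 < Real.logb 2 (1 / ε) := by
  rw [Real.lt_logb_iff_rpow_lt (by norm_num) (by positivity), Real.rpow_one, lt_div_iff₀ hε]
  linarith

lemma logb_inv_le_inv (hε : 0 < ε) (hε2 : ε < 1 / 2) : Real.logb 2 (1 / ε) ≤ 1 / ε := by
  have hbernoulli :=
    one_add_mul_self_le_rpow_one_add (s := 1) (by norm_num) (one_lt_logb_inv hε hε2).le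
  rw [one_add_one_eq_two, Real.rpow_logb (by norm_num) (by norm_num) (by positivity)] at hbernoulli
  linarith

lemma log_le_of_le_two_pow_mul {x : ℝ} {a b : ℕ} (hx : 0 < x) (hε : 0 < ε) (hε2 : ε < 1 / 2)
    (h : x ≤ 2 ^ a * (1 / ε) ^ b) : Real.log x ≤ 7 / 10 * (a + b * Real.logb 2 (1 / ε)) := by
  have hlog2 : Real.log 2 ≤ 7 / 10 := by linarith [Real.log_two_lt_d9]
  have hlog : Real.log (1 / ε) = Real.log 2 * Real.logb 2 (1 / ε) := by
    rw [Real.logb]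
    field_simp
  have hL := one_lt_logb_inv hε hε2
  calc Real.log x ≤ Real.log (2 ^ a * (1 / ε) ^ b) := Real.log_le_log hx h
    _ = Real.log 2 * (a + b * Real.logb 2 (1 / ε)) := by
      rw [Real.log_mul (by positivity) (by positivity), Real.log_pow, Real.log_pow, hlog]
      ring
    _ ≤ 7 / 10 * (a + b * Real.logb 2 (1 / ε)) := by gcongr

lemma natCast_le_of_two_pow_le {k a : ℕ} (hε : 0 < ε) (h : (2 : ℝ) ^ k ≤ 2 ^ a * (1 / ε)) :
    (k : ℝ) ≤ a + Real.logb 2 (1 / ε) := by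
  have := Real.logb_le_logb_of_le (b := 2) (by norm_num) (by positivity) h
  rwa [Real.logb_mul (by positivity) (by positivity), Real.logb_pow, Real.logb_pow,
    Real.logb_self_eq_one (by norm_num), mul_one, mul_one] at this

lemma exists_two_pow_near {x : ℝ} (hx : 1 ≤ x) : ∃ k : ℕ, x ≤ 2 ^ k ∧ (2 : ℝ) ^ k ≤ 2 * x := by
  obtain ⟨k, hk, hk'⟩ := exists_nat_pow_near hx (one_lt_two : (1 : ℝ) < 2)
  exact ⟨k + 1, hk'.le, by rw [pow_succ]; linarith⟩

lemma exists_containerParams (hρ : 0 < ρ) (hρ1 : ρ ≤ 1) (hε : 0 < ε) (hε2 : ε < 1 / 2)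
    (hερ : ε ≤ ρ ^ 2) :
    ∃ P : ContainerParams, P.ρ = ρ ∧ P.ε = ε ∧
      P.μ = ε / (10 ^ 10 * Real.logb 2 (1 / ε) ^ 3) ∧ ε / (16 * ρ) ≤ P.scale P.I := by
  have hL := one_lt_logb_inv hε hε2
  have hLε := logb_inv_le_inv hε hε2
  set L := Real.logb 2 (1 / ε) with hLdef
  obtain ⟨I, hI, hI'⟩ := exists_two_pow_near (x := 8 * ρ ^ 2 / ε)
    (by rw [le_div_iff₀ hε]; linarith)
  obtain ⟨α, hα, hα'⟩ := exists_two_pow_near (x := 800 * L) (by linarith)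
  rw [div_le_iff₀ hε] at hI
  have hεI : ε * 2 ^ I ≤ 16 * ρ ^ 2 := by
    rw [← mul_div_assoc, le_div_iff₀ hε] at hI'
    linarith
  have hρ2 : ρ ^ 2 ≤ ρ := by nlinarith
  have hIlog := natCast_le_of_two_pow_le (k := I) (a := 4) hε
    (by rw [mul_one_div, le_div_iff₀ hε]; linarith)
  have hαlog := natCast_le_of_two_pow_le (k := α) (a := 11) hε (by linarith)
  have hlogI := log_le_of_le_two_pow_mul (x := 2 ^ I / ρ) (a := 4) (b := 1) (by positivity) hε hε2
    (by rw [pow_one, mul_one_div, div_le_div_iff₀ hρ hε]; linarith)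
  rw [← hLdef] at hIlog hαlog hlogI
  push_cast at hIlog hαlog hlogI
  refine ⟨⟨ρ, ε, ε / (10 ^ 10 * L ^ 3), 100 * L, I, α, hρ, hρ1, hε, hερ, by positivity,
    by linarith, by linarith, by linarith, by linarith, ?_, ?_⟩, rfl, rfl, rfl, ?_⟩
  · calc 20000 * (100 * L) ^ 2 * (I + α + 1) * (ε / (10 ^ 10 * L ^ 3))
        ≤ 20000 * (100 * L) ^ 2 * (18 * L) * (ε / (10 ^ 10 * L ^ 3)) := by gcongr; linarith
      _ = 36 / 100 * ε := by field_simp; norm_num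
      _ ≤ ε := by linarith
  · rw [pow_add, pow_add, pow_one, div_le_div_iff₀ hρ (by positivity)]
    calc 8 * (ε / (10 ^ 10 * L ^ 3)) * (2 ^ I * 2 ^ α * 2)
        ≤ 8 * (ε / (10 ^ 10 * L ^ 3)) * (2 ^ I * (2 * (800 * L)) * 2) := by gcongr
      _ = 25600 / 10 ^ 10 * (1 / L ^ 2) * (ε * 2 ^ I) := by field_simp; norm_num
      _ ≤ 25600 / 10 ^ 10 * 1 * (16 * ρ ^ 2) := by
        gcongr
        exact div_le_one_of_le₀ (one_le_pow₀ hL.le) (by positivity)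
      _ ≤ ρ * ρ := by nlinarith [mul_pos hρ hρ]
  · rw [ContainerParams.scale, div_le_div_iff₀ (by positivity) (by positivity)]
    linarith

lemma sampleSize_lt (hρ : 0 < ρ) (hε : 0 < ε) (hε2 : ε < 1 / 2) :
    (sampleSize ρ ε : ℝ) < 10 ^ 14 * (ρ ^ 3 * Real.logb 2 (1 / ε) ^ 5 / ε ^ 2) + 1 := by
  have := one_lt_logb_inv hε hε2
  exact Nat.ceil_lt_add_one (by positivity)

lemma log_sampleSize_le (hρ : 0 < ρ) (hρ1 : ρ ≤ 1) (hε : 0 < ε) (hε2 : ε < 1 / 2)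
    (hs : 0 < sampleSize ρ ε) :
    Real.log (32 * sampleSize ρ ε) ≤ 300 * Real.logb 2 (1 / ε) ^ 2 := by
  have hL := one_lt_logb_inv hε hε2
  have hLε := logb_inv_le_inv hε hε2
  have hsize := sampleSize_lt hρ hε hε2
  have hlog := log_le_of_le_two_pow_mul (x := 32 * sampleSize ρ ε) (a := 53) (b := 7)
    (mul_pos (by norm_num) (by exact_mod_cast hs)) hε hε2
  set L := Real.logb 2 (1 / ε)
  have hpow : 10 ^ 14 * (ρ ^ 3 * L ^ 5 / ε ^ 2) ≤ 10 ^ 14 * (1 / ε) ^ 7 :=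
    calc 10 ^ 14 * (ρ ^ 3 * L ^ 5 / ε ^ 2) = 10 ^ 14 * (ρ ^ 3 * L ^ 5 * (1 / ε) ^ 2) := by ring
      _ ≤ 10 ^ 14 * (1 * (1 / ε) ^ 5 * (1 / ε) ^ 2) := by
        gcongr
        exact pow_le_one₀ hρ.le hρ1
      _ = 10 ^ 14 * (1 / ε) ^ 7 := by ring
  have hone : 1 ≤ (1 / ε) ^ 7 := one_le_pow₀ (hL.le.trans hLε)
  refine (hlog (by linarith)).trans ?_
  push_cast
  nlinarith

lemma sampleSize_le (hρ : 0 < ρ) (hε : 0 < ε) (hε2 : ε < 1 / 2) (hερ : ε ≤ ρ ^ 2) :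
    (sampleSize ρ ε : ℝ) ≤
      64 * 10 ^ 14 * (ρ ^ 3 / ε ^ 2) * Real.logb 2 (2 + ρ ^ 3 / ε ^ 2) ^ 5 := by
  have hL := one_lt_logb_inv hε hε2
  have hsize := sampleSize_lt hρ hε hε2
  rw [mul_div_right_comm] at hsize
  set Y := ρ ^ 3 / ε ^ 2 with hY
  set L := Real.logb 2 (1 / ε)
  have hY0 : 0 < Y := by positivity
  have hεY : 1 / ε ≤ Y ^ 2 := by
    rw [hY, div_pow, div_le_div_iff₀ hε (by positivity)]
    calc 1 * (ε ^ 2) ^ 2 = ε ^ 3 * ε := by ring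
      _ ≤ (ρ ^ 2) ^ 3 * ε := by gcongr
      _ = (ρ ^ 3) ^ 2 * ε := by ring
  have hY1 : 1 ≤ Y := by
    have : 1 < 1 / ε := by
      rw [lt_div_iff₀ hε]
      linarith
    exact (one_lt_pow_iff_of_nonneg hY0.le two_ne_zero).1 (this.trans_le hεY) |>.le
  have hLY : L ≤ 2 * Real.logb 2 (2 + Y) :=
    calc L ≤ Real.logb 2 (Y ^ 2) :=
          Real.logb_le_logb_of_le (by norm_num) (by positivity) hεY
      _ = 2 * Real.logb 2 Y := by rw [Real.logb_pow]; norm_num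
      _ ≤ 2 * Real.logb 2 (2 + Y) := by
        gcongr
        · norm_num
        · linarith
  have hone : 1 ≤ Y * L ^ 5 := one_le_mul_of_one_le_of_one_le hY1 (one_le_pow₀ hL.le)
  calc (sampleSize ρ ε : ℝ) ≤ 2 * 10 ^ 14 * Y * L ^ 5 := by linarith
    _ ≤ 2 * 10 ^ 14 * Y * (2 * Real.logb 2 (2 + Y)) ^ 5 := by gcongr
    _ = 64 * 10 ^ 14 * Y * Real.logb 2 (2 + Y) ^ 5 := by ring

lemma tolerance_lt (hε : 0 < ε) (hε2 : ε < 1 / 2) : tolerance ε < ε :=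
  div_lt_self hε (by linarith [one_le_pow₀ (one_lt_logb_inv hε hε2).le (n := 4)])

end Parameters

section Soundness

variable {P : ContainerParams}

lemma le_unitCost_mul_sampleSize (hL : 0 < Real.logb 2 (1 / P.ε))
    (hμ : P.μ = P.ε / (10 ^ 10 * Real.logb 2 (1 / P.ε) ^ 3)) :
    80000 * (P.ρ ^ 2 * Real.logb 2 (1 / P.ε) ^ 2 / P.ε) ≤ P.unitCost * sampleSize P.ρ P.ε := by
  have hρ := P.ρ_pos
  have hε := P.ε_pos
  set L := Real.logb 2 (1 / P.ε)
  calc 80000 * (P.ρ ^ 2 * L ^ 2 / P.ε)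
      = P.unitCost * (10 ^ 14 * (P.ρ ^ 3 * L ^ 5 / P.ε ^ 2)) := by
        rw [ContainerParams.unitCost, hμ]
        field_simp
        norm_num
    _ ≤ P.unitCost * sampleSize P.ρ P.ε :=
        mul_le_mul_of_nonneg_left (Nat.le_ceil _) P.unitCost_pos.le

lemma hundred_le_scale_mul_sampleSize (hL : 1 < Real.logb 2 (1 / P.ε))
    (hI : P.ε / (16 * P.ρ) ≤ P.scale P.I) : 100 ≤ P.scale P.I * sampleSize P.ρ P.ε := by
  have hρ := P.ρ_pos
  have hε := P.ε_pos
  set L := Real.logb 2 (1 / P.ε)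
  calc (100 : ℝ) ≤ 10 ^ 14 / 16 * 1 * 1 := by norm_num
    _ ≤ 10 ^ 14 / 16 * (P.ρ ^ 2 / P.ε) * L ^ 5 := by
      gcongr
      · exact (one_le_div hε).2 P.ε_le
      · exact one_le_pow₀ hL.le
    _ = P.ε / (16 * P.ρ) * (10 ^ 14 * (P.ρ ^ 3 * L ^ 5 / P.ε ^ 2)) := by field_simp
    _ ≤ P.scale P.I * sampleSize P.ρ P.ε :=
      mul_le_mul hI (Nat.le_ceil _) (by positivity) (P.scale_pos _).le

lemma le_sq_scale_mul_sampleSize (hL : 1 < Real.logb 2 (1 / P.ε))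
    (hI : P.ε / (16 * P.ρ) ≤ P.scale P.I) :
    64 * P.ρ ≤ P.scale P.I ^ 2 * sampleSize P.ρ P.ε := by
  have hρ := P.ρ_pos
  have hε := P.ε_pos
  set L := Real.logb 2 (1 / P.ε)
  calc 64 * P.ρ ≤ 10 ^ 14 / 256 * P.ρ * 1 := by linarith
    _ ≤ 10 ^ 14 / 256 * P.ρ * L ^ 5 := by
      gcongr
      exact one_le_pow₀ hL.le
    _ = (P.ε / (16 * P.ρ)) ^ 2 * (10 ^ 14 * (P.ρ ^ 3 * L ^ 5 / P.ε ^ 2)) := by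
      field_simp
      norm_num
    _ ≤ P.scale P.I ^ 2 * sampleSize P.ρ P.ε :=
      mul_le_mul (by gcongr) (Nat.le_ceil _) (by positivity) (by positivity)

open Classical in
lemma card_filter_isCaptured_sampleSize_le {V : Type*} [Fintype V] [DecidableEq V]
    {G : SimpleGraph V} (hε2 : P.ε < 1 / 2)
    (hμ : P.μ = P.ε / (10 ^ 10 * Real.logb 2 (1 / P.ε) ^ 3))
    (hI : P.ε / (16 * P.ρ) ≤ P.scale P.I) (hs : sampleSize P.ρ P.ε ≤ Fintype.card V) :
    (#{S ∈ (univ : Finset V).powersetCard (sampleSize P.ρ P.ε) |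
      IsCaptured G P.ρ (P.scale P.I) P.unitCost (sampleSize P.ρ P.ε) S} : ℝ) ≤
      1 / 16 * (Fintype.card V).choose (sampleSize P.ρ P.ε) := by
  have hρ := P.ρ_pos
  have hε := P.ε_pos
  have hL := one_lt_logb_inv hε hε2
  have hcost := le_unitCost_mul_sampleSize (one_pos.trans hL) hμ
  have hs0 : 0 < sampleSize P.ρ P.ε := by
    refine Nat.pos_of_ne_zero fun h => ?_
    have := hundred_le_scale_mul_sampleSize hL hI
    rw [h, Nat.cast_zero, mul_zero] at this
    linarith
  have hlog := log_sampleSize_le hρ P.ρ_le_one hε hε2 hs0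
  have hsq := le_sq_scale_mul_sampleSize hL hI
  set L := Real.logb 2 (1 / P.ε)
  refine card_filter_isCaptured_le hs hs0 hρ (P.scale_pos _) P.unitCost_pos ?_ hsq ?_
  · calc P.ρ ≤ 80000 * (1 * 1) := by linarith [P.ρ_le_one]
      _ ≤ 80000 * (P.ρ ^ 2 / P.ε * L ^ 2) := by
        gcongr
        · exact (one_le_div hε).2 P.ε_le
        · exact one_le_pow₀ hL.le
      _ = 80000 * (P.ρ ^ 2 * L ^ 2 / P.ε) := by ring
      _ ≤ P.unitCost * sampleSize P.ρ P.ε := hcost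
  · calc Real.log (32 * sampleSize P.ρ P.ε) ≤ 300 * L ^ 2 := hlog
      _ ≤ 312.5 * L ^ 2 := by gcongr; norm_num
      _ = P.ε / (16 * P.ρ) * (80000 * (P.ρ ^ 2 * L ^ 2 / P.ε)) / (16 * P.ρ) := by
        field_simp
        norm_num
      _ ≤ P.scale P.I * (P.unitCost * sampleSize P.ρ P.ε) / (16 * P.ρ) := by
        gcongr
        exact (P.scale_pos _).le
      _ = P.scale P.I * P.unitCost * sampleSize P.ρ P.ε / (16 * P.ρ) := by ring

lemma isCaptured_of_isFar {n : ℕ} {G : SimpleGraph (Fin n)} {J : Finset (Fin n)}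
    (hG : IsFar (IndepSetProperty n P.ρ) P.ε G) (hε2 : P.ε < 1 / 2)
    (hμ : P.μ = P.ε / (10 ^ 10 * Real.logb 2 (1 / P.ε) ^ 3))
    (hI : P.ε / (16 * P.ρ) ≤ P.scale P.I) (hs : sampleSize P.ρ P.ε ≤ n)
    (hJ : #J = ⌊P.ρ * sampleSize P.ρ P.ε⌋₊)
    (hadj : (adjPairs G J J : ℝ) ≤ 2 * (2 * tolerance P.ε * sampleSize P.ρ P.ε ^ 2)) :
    IsCaptured G P.ρ (P.scale P.I) P.unitCost (sampleSize P.ρ P.ε) J := by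
  have hρ := P.ρ_pos
  have hε := P.ε_pos
  have hL := one_lt_logb_inv hε hε2
  have h100 := hundred_le_scale_mul_sampleSize hL hI
  have htol : tolerance P.ε ≤ P.μ := by
    rw [tolerance, hμ]
    gcongr
    · exact hL.le
    · norm_num
  by_contra hcap
  refine not_hasSparseSet_of_isFar hG (SparseSetting.hasSparseSet
    { toContainerParams := P, G := G, J := J, s := sampleSize P.ρ P.ε, s_pos := ?_, card_V := ?_,
      sparse := ?_, le_card_J := ?_, card_J_le := ?_, not_isCaptured := hcap })
  · exact pos_of_mul_pos_right (by linarith) (P.scale_pos P.I).le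
  · rw [Fintype.card_fin]
    have : P.scale P.I * sampleSize P.ρ P.ε ≤ P.scale P.I * n := by
      gcongr
      exact (P.scale_pos _).le
    linarith
  · calc (adjPairs G J J : ℝ) ≤ 2 * (2 * tolerance P.ε * sampleSize P.ρ P.ε ^ 2) := hadj
      _ = 4 * tolerance P.ε * sampleSize P.ρ P.ε ^ 2 := by ring
      _ ≤ 4 * P.μ * sampleSize P.ρ P.ε ^ 2 := by gcongr
  · have := Nat.lt_floor_add_one (P.ρ * sampleSize P.ρ P.ε)
    rw [hJ]
    linarith
  · rw [hJ]
    exact Nat.floor_le (by positivity)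

variable {n : ℕ} {ε ρ : ℝ} {G : SimpleGraph (Fin n)}

lemma acceptProb_le_of_isFar (hn : 0 < n) (hρ : 0 < ρ) (hρ1 : ρ ≤ 1) (hε : 0 < ε)
    (hs : sampleSize ρ ε ≤ n) (hG : IsFar (IndepSetProperty n ρ) ε G) :
    acceptProb (sampleSize ρ ε) (sparseSubsetRule n ⌊ρ * sampleSize ρ ε⌋₊
      (2 * tolerance ε * sampleSize ρ ε ^ 2)) G ≤ 1 / 16 := by
  classical
  obtain ⟨hε2, hερ⟩ := lt_half_and_le_sq_of_isFar hn hρ hρ1 hε hG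
  obtain ⟨P, rfl, rfl, hμ, hI⟩ := exists_containerParams hρ hρ1 hε hε2 hερ
  have hfew := card_filter_isCaptured_sampleSize_le (G := G) hε2 hμ hI
    (hs.trans_eq (Fintype.card_fin n).symm)
  rw [Fintype.card_fin] at hfew
  have hchoose : (0 : ℝ) < n.choose (sampleSize P.ρ P.ε) := by exact_mod_cast Nat.choose_pos hs
  rw [acceptProb_sparseSubsetRule, div_le_iff₀ hchoose]
  refine (Nat.cast_le.2 (card_le_card ?_)).trans hfew
  refine monotone_filter_right _ fun S _ => ?_
  rintro ⟨J, hJS, hJ, hadj⟩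
  exact (isCaptured_of_isFar hG hε2 hμ hI hs hJ hadj).mono hJS

end Soundness

section SampleComplexity

variable {n : ℕ} {ε ρ δ₁ δ₂ ε₁ ε₂ : ℝ} {P : Set (SimpleGraph (Fin n))}

lemma isTolerantTester_sparseSubsetRule (hn : 0 < n) (hρ : 0 < ρ) (hρ1 : ρ ≤ 1) (hε : 0 < ε)
    (hs : sampleSize ρ ε ≤ n) :
    IsTolerantTester (1 / 8) (1 / 16) (tolerance ε) ε (IndepSetProperty n ρ) (sampleSize ρ ε)
      (sparseSubsetRule n ⌊ρ * sampleSize ρ ε⌋₊ (2 * tolerance ε * sampleSize ρ ε ^ 2)) :=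
  ⟨hs, fun _ hG => le_acceptProb_of_isClose hn hs hρ hG,
    fun _ hG => acceptProb_le_of_isFar hn hρ hρ1 hε hs hG⟩

lemma IsTolerantTester.exists_sampleComplexity_eq {s : ℕ} {A : DecisionRule n}
    (h : IsTolerantTester δ₁ δ₂ ε₁ ε₂ P s A) :
    ∃ t : ℕ, sampleComplexity δ₁ δ₂ ε₁ ε₂ P = t ∧ t ≤ s := by
  have hle : sampleComplexity δ₁ δ₂ ε₁ ε₂ P ≤ s := iInf₂_le s ⟨A, h⟩
  obtain ⟨t, ht⟩ := ENat.ne_top_iff_exists.1 (hle.trans_lt (ENat.natCast_lt_top s)).ne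
  exact ⟨t, ht.symm, by exact_mod_cast ht.trans_le hle⟩

lemma isTolerantTester_zero (hδ : δ₁ ≤ 1) (hP : ∀ G, ¬ IsFar P ε₂ G) :
    IsTolerantTester δ₁ δ₂ ε₁ ε₂ P 0 fun _ _ => 1 := by
  refine ⟨Nat.zero_le _, fun G _ => ?_, fun G hG => (hP G hG).elim⟩
  simpa [acceptProb] using hδ

lemma IsClose.not_isFar {G : SimpleGraph (Fin n)} (hn : 0 < n) (hε : ε₁ < ε₂)
    (hG : IsClose P ε₁ G) : ¬ IsFar P ε₂ G := by
  obtain ⟨H, hH, hd⟩ := hG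
  exact fun hfar => hε.not_ge (le_of_mul_le_mul_right ((hfar H hH).trans hd)
    (pow_pos (Nat.cast_pos.2 hn) 2))

lemma induce_univ_injective {V : Type*} [Fintype V] :
    Function.Injective fun G : SimpleGraph V => G.induce ((univ : Finset V) : Set V) := by
  intro G G' h
  ext a b
  exact iff_of_eq (congrArg (fun H => H.Adj ⟨a, by simp⟩ ⟨b, by simp⟩) h)

open Classical in
lemma exists_isTolerantTester_self (P : Set (SimpleGraph (Fin n))) (hn : 0 < n) (hδ₁ : δ₁ ≤ 1)
    (hδ₂ : 0 ≤ δ₂) (hε : ε₁ < ε₂) : ∃ A, IsTolerantTester δ₁ δ₂ ε₁ ε₂ P n A := by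
  let A : DecisionRule n := fun S H =>
    if ∃ G, IsClose P ε₁ G ∧ G.induce (S : Set (Fin n)) = H then 1 else 0
  have hA (G : SimpleGraph (Fin n)) : acceptProb n A G = if IsClose P ε₁ G then 1 else 0 := by
    have hsample : (univ : Finset (Fin n)).powersetCard n = {univ} := by
      simpa using powersetCard_self (univ : Finset (Fin n))
    have hiff : (∃ G', IsClose P ε₁ G' ∧ G'.induce ((univ : Finset (Fin n)) : Set (Fin n)) =
        G.induce ((univ : Finset (Fin n)) : Set (Fin n))) ↔ IsClose P ε₁ G :=
      ⟨fun ⟨_, hG', h⟩ => induce_univ_injective h ▸ hG', fun h => ⟨G, h, rfl⟩⟩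
    rw [acceptProb, hsample, sum_singleton, Nat.choose_self, Nat.cast_one, div_one]
    simp only [A, hiff]
    split_ifs <;> rfl
  refine ⟨A, le_rfl, fun G hG => ?_, fun G hG => ?_⟩
  · rwa [hA, if_pos hG]
  · rwa [hA, if_neg fun hclose => hclose.not_isFar hn hε hG]

lemma exists_isTolerantTester_le_sampleSize (hn : 0 < n) (hρ : 0 < ρ) (hρ1 : ρ ≤ 1) (hε : 0 < ε)
    (hε2 : ε < 1 / 2) :
    ∃ s ≤ sampleSize ρ ε, ∃ A,
      IsTolerantTester (1 / 8) (1 / 16) (tolerance ε) ε (IndepSetProperty n ρ) s A := by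
  obtain hs | hs := le_or_gt (sampleSize ρ ε) n
  · exact ⟨_, le_rfl, _, isTolerantTester_sparseSubsetRule hn hρ hρ1 hε hs⟩
  · exact ⟨n, hs.le, exists_isTolerantTester_self _ hn (by norm_num) (by norm_num)
      (tolerance_lt hε hε2)⟩

lemma exists_sampleComplexity_eq_and_le (hn : 0 < n) (hρ : 0 < ρ) (hρ1 : ρ ≤ 1) (hε : 0 < ε) :
    ∃ s : ℕ, sampleComplexity (1 / 8) (1 / 16) (tolerance ε) ε (IndepSetProperty n ρ) = s ∧
      (s : ℝ) ≤ 64 * 10 ^ 14 * (ρ ^ 3 / ε ^ 2) * Real.logb 2 (2 + ρ ^ 3 / ε ^ 2) ^ 5 := by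
  by_cases h : ε < 1 / 2 ∧ ε ≤ ρ ^ 2
  · obtain ⟨s, hs, A, hA⟩ := exists_isTolerantTester_le_sampleSize hn hρ hρ1 hε h.1
    obtain ⟨t, ht, hts⟩ := hA.exists_sampleComplexity_eq
    exact ⟨t, ht, (Nat.cast_le.2 (hts.trans hs)).trans (sampleSize_le hρ hε h.1 h.2)⟩
  · have htester : IsTolerantTester (1 / 8) (1 / 16) (tolerance ε) ε (IndepSetProperty n ρ) 0
        fun _ _ => 1 :=
      isTolerantTester_zero (by norm_num) fun G hG =>
        h (lt_half_and_le_sq_of_isFar hn hρ hρ1 hε hG)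
    obtain ⟨t, ht, ht0⟩ := htester.exists_sampleComplexity_eq
    refine ⟨t, ht, ?_⟩
    have hY : 0 < ρ ^ 3 / ε ^ 2 := by positivity
    have := Real.logb_nonneg one_lt_two (by linarith : 1 ≤ 2 + ρ ^ 3 / ε ^ 2)
    rw [Nat.le_zero.1 ht0, Nat.cast_zero]
    positivity

end SampleComplexity

end DenseTesting

theorem theorem1 :
    ∃ c C₁ C₂ δ₁ δ₂ : ℝ, 0 < c ∧ 0 < C₁ ∧ 0 < C₂ ∧ 0 < δ₂ ∧ δ₂ < δ₁ ∧ δ₁ < 1 ∧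
      ∀ ε : ℝ, 0 < ε → ∀ ρ : ℝ, 0 < ρ → ρ ≤ 1 → ∀ n : ℕ, 0 < n →
        (∃ s : ℕ,
          DenseTesting.sampleComplexity δ₁ δ₂ (ε / (c * (Real.logb 2 (1 / ε)) ^ 4)) ε
              (DenseTesting.IndepSetProperty n ρ) = (s : ℕ∞) ∧
          (s : ℝ) ≤ C₁ * (ρ ^ 3 / ε ^ 2) * (Real.logb 2 (2 + ρ ^ 3 / ε ^ 2)) ^ 5) ∧
        (∀ s : ℕ, s = ⌈C₂ * (ρ ^ 3 * (Real.logb 2 (1 / ε)) ^ 5 / ε ^ 2)⌉₊ → s ≤ n →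
          DenseTesting.IsTolerantTester δ₁ δ₂ (ε / (c * (Real.logb 2 (1 / ε)) ^ 4)) ε
            (DenseTesting.IndepSetProperty n ρ) s
            (DenseTesting.sparseSubsetRule n ⌊ρ * (s : ℝ)⌋₊
              (2 * (ε / (c * (Real.logb 2 (1 / ε)) ^ 4)) * (s : ℝ) ^ 2))) := by
  refine ⟨10 ^ 10, 64 * 10 ^ 14, 10 ^ 14, 1 / 8, 1 / 16, by norm_num, by norm_num, by norm_num,
    by norm_num, by norm_num, by norm_num, fun ε hε ρ hρ hρ1 n hn => ⟨?_, ?_⟩⟩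
  · exact DenseTesting.exists_sampleComplexity_eq_and_le hn hρ hρ1 hε
  · rintro _ rfl hs
    exact DenseTesting.isTolerantTester_sparseSubsetRule hn hρ hρ1 hε hs
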